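/- Let $0<q<1$. Write $[n]=\frac{1-q^n}{1-q}$, $[n]!=[1][2]\cdots[n]$ with $[0]!=1$, $E_q(z)=\prod_{k=0}^{\infty}\bigl(1+(1-q)q^k z\bigr)$ for $z\in\mathbb{C}$, and $$\mathrm{Sin}_q z=\frac{E_q(iz)-E_q(-iz)}{2i},\qquad \mathrm{Cos}_q z=\frac{E_q(iz)+E_q(-iz)}{2}.$$ The positive zeros of $\mathrm{Sin}_q$ and of $\mathrm{Cos}_q$ are simple and form infinite sequences, which in increasing order we denote by $(\xi_k)_{k\ge1}$ and $(\eta_k)_{k\ge1}$ respectively. The series $$\eta_q(s)=-\sum_{k=1}^{\infty}\frac{1}{\xi_k^{s}}\frac{1}{\mathrm{Sin}_q'\xi_k},\qquad \eta_q^*(s)=-\sum_{k=1}^{\infty}\frac{1}{\eta_k^{s}}\frac{1}{\mathrm{Cos}_q'\eta_k}$$ converge absolutely for all $s\in\mathbb{C}$, and the series $$\zeta_q(s)=\sum_{k=1}^{\infty}\frac{\mathrm{Cos}_q\xi_k}{\mathrm{Sin}_q'\xi_k}\frac{1}{\xi_k^{s}},\qquad \zeta_q^*(s)=-\sum_{k=1}^{\infty}\frac{\mathrm{Sin}_q\eta_k}{\mathrm{Cos}_q'\eta_k}\frac{1}{\eta_k^{s}}$$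 converge absolutely for $\operatorname{Re}s>1$. For $\operatorname{Re}s>1$, $$\zeta_q(s)=\sum_{j=0}^{\infty}\frac{(-1)^{j+1}}{[2j]!}\,q^{j(2j-1)}\,\eta_q(s-2j),\qquad \zeta_q^*(s)=\sum_{j=0}^{\infty}\frac{(-1)^{j}}{[2j+1]!}\,q^{j(2j+1)}\,\eta_q^*(s-2j-1),$$ where both series converge absolutely. In particular, for every integer $n\ge1$, $$\zeta_q(2n)=\sum_{j=0}^{n}\frac{(-1)^{j+1}}{[2j]!}\,q^{j(2j-1)}\,\eta_q(2n-2j),\qquad \zeta_q^*(2n)=\sum_{j=0}^{n-1}\frac{(-1)^{j}}{[2j+1]!}\,q^{j(2j+1)}\,\eta_q^*(2n-2j-1).$$ -/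

import Mathlib

noncomputable section

/-- The `q`-number `[n] = (1 - q^n) / (1 - q)`. -/
def qNumber (q : ℝ) (n : ℕ) : ℝ := (1 - q ^ n) / (1 - q)

/-- The `q`-factorial `[n]! = [1] [2] ⋯ [n]`, with `[0]! = 1`. -/
def qFact (q : ℝ) (n : ℕ) : ℝ := ∏ i ∈ Finset.range n, qNumber q (i + 1)

/-- The infinite `q`-shifted factorial `(a; q)_∞ = ∏_{k ≥ 0} (1 - a q^k)`. -/
def qShiftedFactInf (a : ℂ) (q : ℝ) : ℂ := ∏' k : ℕ, (1 - a * (q : ℂ) ^ k)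

/-- The `q`-exponential function `E_q(z) = (-(1 - q) z; q)_∞`. -/
def bigQExp (q : ℝ) (z : ℂ) : ℂ := qShiftedFactInf (-(1 - (q : ℂ)) * z) q

/-- `Sin_q z = (E_q(iz) - E_q(-iz)) / (2i)`. -/
def qSin (q : ℝ) (z : ℂ) : ℂ :=
  (bigQExp q (Complex.I * z) - bigQExp q (-Complex.I * z)) / (2 * Complex.I)

/-- `Cos_q z = (E_q(iz) + E_q(-iz)) / 2`. -/
def qCos (q : ℝ) (z : ℂ) : ℂ :=
  (bigQExp q (Complex.I * z) + bigQExp q (-Complex.I * z)) / 2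

/-- The positive real zeros of `f` in increasing order, numbered from `0`:
the smallest one, and after each one the next larger one. -/
def posZero (f : ℂ → ℂ) : ℕ → ℝ
  | 0 => sInf {x : ℝ | 0 < x ∧ f (x : ℂ) = 0}
  | k + 1 => sInf {x : ℝ | posZero f k < x ∧ f (x : ℂ) = 0}

/-- The sequence `x` lists all the positive real zeros of `f` in increasing order, and they are
simple. -/
def ListsSimplePosZeros (f : ℂ → ℂ) (x : ℕ → ℝ) : Prop :=
  StrictMono x ∧ Set.range x = {t : ℝ | 0 < t ∧ f (t : ℂ) = 0} ∧ ∀ k, deriv f (x k : ℂ) ≠ 0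

/-- The positive zeros of `Sin_q`; `sinZero q k` is the zero usually numbered `k + 1`. -/
def sinZero (q : ℝ) (k : ℕ) : ℝ := posZero (qSin q) k

/-- The positive zeros of `Cos_q`; `cosZero q k` is the zero usually numbered `k + 1`. -/
def cosZero (q : ℝ) (k : ℕ) : ℝ := posZero (qCos q) k

/-- The terms of the series that defines `ζ_q(s)`. -/
def qZetaTerm (q : ℝ) (s : ℂ) (k : ℕ) : ℂ :=
  qCos q (sinZero q k) / deriv (qSin q) (sinZero q k) * (1 / (sinZero q k : ℂ) ^ s)

/-- `ζ_q(s) = ∑_k (Cos_q ξ_k / Sin_q' ξ_k) ξ_k^{-s}` over the positive zeros `ξ_k` of `Sin_q`. -/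
def qZeta (q : ℝ) (s : ℂ) : ℂ := ∑' k : ℕ, qZetaTerm q s k

/-- The terms of the series that defines `ζ_q^*(s)`. -/
def qZetaStarTerm (q : ℝ) (s : ℂ) (k : ℕ) : ℂ :=
  qSin q (cosZero q k) / deriv (qCos q) (cosZero q k) * (1 / (cosZero q k : ℂ) ^ s)

/-- `ζ_q^*(s) = -∑_k (Sin_q η_k / Cos_q' η_k) η_k^{-s}` over the positive zeros `η_k` of `Cos_q`. -/
def qZetaStar (q : ℝ) (s : ℂ) : ℂ := -∑' k : ℕ, qZetaStarTerm q s k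

/-- The terms of the series that defines `η_q(s)`. -/
def qEtaTerm (q : ℝ) (s : ℂ) (k : ℕ) : ℂ :=
  1 / (sinZero q k : ℂ) ^ s * (1 / deriv (qSin q) (sinZero q k))

/-- `η_q(s) = -∑_k ξ_k^{-s} / Sin_q' ξ_k` over the positive zeros `ξ_k` of `Sin_q`. -/
def qEta (q : ℝ) (s : ℂ) : ℂ := -∑' k : ℕ, qEtaTerm q s k

/-- The terms of the series that defines `η_q^*(s)`. -/
def qEtaStarTerm (q : ℝ) (s : ℂ) (k : ℕ) : ℂ :=
  1 / (cosZero q k : ℂ) ^ s * (1 / deriv (qCos q) (cosZero q k))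

/-- `η_q^*(s) = -∑_k η_k^{-s} / Cos_q' η_k` over the positive zeros `η_k` of `Cos_q`. -/
def qEtaStar (q : ℝ) (s : ℂ) : ℂ := -∑' k : ℕ, qEtaStarTerm q s k

end

/-! On the real axis `E_q(ix) = ∏ (1 + i c_k x)` with `c_k = (1 - q) q^k`. Taking each factor in
polar form gives `E_q(ix) = exp (L(x) + i φ(x))`, where `L` is `logMod` and `φ = ∑ arctan (c_k x)`
is `phase`. Hence `Sin_q = e^L sin φ` and `Cos_q = e^L cos φ`. Since `φ` increases strictly from 0
to infinity, the positive zeros are the points where `φ` equals `(k + 1) π`, respectively `(k + 1/2)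
π`. At a zero the derivative is `± e^L φ'`, so the zeros are simple. The `η` terms have size `x^(-Re
s) / (e^L φ')`, where `e^L` beats every power. In the `ζ` terms `e^L` cancels and `1 / φ' = O(x)`
remains. The zeros grow at least like `q^(-2k)`, which gives convergence in both cases.

The expansions come from inserting the power series of `Cos_q` or `Sin_q` at each zero and
exchanging the two sums. This needs the absolute series at `x`, which is at most `E_q(x)`, to be no
larger than a constant times `e^L = |E_q(ix)|`. That is `tsum_qExpCoeff_le`: the ratio of the two is
at most `exp (x φ'(x))`, and `x φ'(x)` is bounded because the weights are geometric. Absolute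
summability is then `IsPhaseSeq.summable_double`.

At `s = 2n` the expansions terminate because `η_q` vanishes at the negative even integers and
`η_q^*` at the negative odd ones. For the product cut off after `2M + 1` factors, sine and cosine
are polynomials in `x²` (times `x` for the sine) with `M` known roots, and the corresponding sums
vanish by Euler's identity `sum_pow_div_eval_derivative`. Dominated convergence as `M → ∞`
(`IsPhaseSeq.tsum_eq_zero`) transfers this to the infinite product. -/

open Filter Topology

/-! ### Modulus and phase of `∏ (1 + i c_k x)` -/

/-- The phase `∑ arctan (c_k x)` of the product `∏ (1 + i c_k x)`. -/
noncomputable def phase (c : ℕ → ℝ) (x : ℝ) : ℝ := ∑' k, Real.arctan (c k * x)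

/-- The derivative of `phase`. -/
noncomputable def phaseDeriv (c : ℕ → ℝ) (x : ℝ) : ℝ := ∑' k, c k / (1 + (c k * x) ^ 2)

/-- The logarithm of the modulus of the product `∏ (1 + i c_k x)`. -/
noncomputable def logMod (c : ℕ → ℝ) (x : ℝ) : ℝ := ∑' k, Real.log (1 + (c k * x) ^ 2) / 2

lemma abs_arctan_le_abs (y : ℝ) : |Real.arctan y| ≤ |y| := by
  have key : ∀ y : ℝ, 0 ≤ y → Real.arctan y ≤ y := fun y hy => by
    have := Real.le_tan (Real.arctan_nonneg.2 hy) (Real.arctan_lt_pi_div_two y)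
    rwa [Real.tan_arctan] at this
  rcases le_total 0 y with h | h
  · rw [abs_of_nonneg h, abs_of_nonneg (Real.arctan_nonneg.2 h)]
    exact key y h
  · rw [abs_of_nonpos h, abs_of_nonpos (Real.arctan_le_zero.2 h), ← Real.arctan_neg]
    exact key (-y) (by linarith)

lemma half_log_one_add_sq_le (y : ℝ) : Real.log (1 + y ^ 2) / 2 ≤ |y| := by
  have h1 : 1 + y ^ 2 ≤ Real.exp |y| ^ 2 := by
    have := Real.add_one_le_exp |y|
    have h2 := abs_nonneg y
    rw [← sq_abs]
    nlinarith
  have h2 := Real.log_le_log (by positivity) h1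
  rw [Real.log_pow, Real.log_exp] at h2
  push_cast at h2
  linarith

lemma half_log_one_add_sq_nonneg (y : ℝ) : 0 ≤ Real.log (1 + y ^ 2) / 2 := by
  have := Real.log_nonneg (show (1 : ℝ) ≤ 1 + y ^ 2 by nlinarith [sq_nonneg y])
  linarith

section Phase

variable {c : ℕ → ℝ}

lemma phaseDeriv_term_nonneg (hc : ∀ k, 0 ≤ c k) (x : ℝ) (k : ℕ) :
    0 ≤ c k / (1 + (c k * x) ^ 2) := div_nonneg (hc k) (by positivity)

lemma phaseDeriv_term_le (hc : ∀ k, 0 ≤ c k) (x : ℝ) (k : ℕ) :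
    c k / (1 + (c k * x) ^ 2) ≤ c k :=
  div_le_self (hc k) (by nlinarith [sq_nonneg (c k * x)])

lemma summable_phase (hc : ∀ k, 0 ≤ c k) (hs : Summable c) (x : ℝ) :
    Summable fun k => Real.arctan (c k * x) := by
  refine Summable.of_norm_bounded (hs.mul_right |x|) fun k => ?_
  rw [Real.norm_eq_abs]
  exact (abs_arctan_le_abs _).trans_eq (by rw [abs_mul, abs_of_nonneg (hc k)])

lemma summable_phaseDeriv (hc : ∀ k, 0 ≤ c k) (hs : Summable c) (x : ℝ) :
    Summable fun k => c k / (1 + (c k * x) ^ 2) :=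
  Summable.of_nonneg_of_le (phaseDeriv_term_nonneg hc x) (phaseDeriv_term_le hc x) hs

lemma summable_logMod (hc : ∀ k, 0 ≤ c k) (hs : Summable c) (x : ℝ) :
    Summable fun k => Real.log (1 + (c k * x) ^ 2) / 2 :=
  Summable.of_nonneg_of_le (fun k => half_log_one_add_sq_nonneg _)
    (fun k => (half_log_one_add_sq_le _).trans_eq (by rw [abs_mul, abs_of_nonneg (hc k)]))
    (hs.mul_right |x|)

lemma hasDerivAt_phase (hc : ∀ k, 0 ≤ c k) (hs : Summable c) (x : ℝ) :
    HasDerivAt (phase c) (phaseDeriv c x) x := by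
  refine hasDerivAt_tsum hs (g := fun k x => Real.arctan (c k * x))
    (g' := fun k x => c k / (1 + (c k * x) ^ 2)) (y₀ := 0) (fun k y => ?_) (fun k y => ?_)
    (by simp) x
  · have := ((hasDerivAt_id y).const_mul (c k)).arctan
    exact this.congr_deriv (by simp [div_eq_inv_mul])
  · rw [Real.norm_of_nonneg (phaseDeriv_term_nonneg hc y k)]
    exact phaseDeriv_term_le hc y k

lemma exists_hasDerivAt_logMod (hc : ∀ k, 0 ≤ c k) (hs : Summable c) (x : ℝ) :
    ∃ d, HasDerivAt (logMod c) d x := by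
  refine ⟨_, hasDerivAt_tsum hs (g := fun k x => Real.log (1 + (c k * x) ^ 2) / 2)
    (g' := fun k x => c k * (c k * x) / (1 + (c k * x) ^ 2)) (y₀ := 0) (fun k y => ?_)
    (fun k y => ?_) (by simp) x⟩
  · have h := ((((hasDerivAt_id y).const_mul (c k)).pow 2).const_add 1).log
      (show 1 + (c k * y) ^ 2 ≠ 0 by positivity)
    exact (h.div_const 2).congr_deriv (by simp; ring)
  · have h1 : |c k * y / (1 + (c k * y) ^ 2)| ≤ 1 := by
      rw [abs_div, abs_of_pos (show 0 < 1 + (c k * y) ^ 2 by positivity),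
        div_le_one (by positivity), ← sq_abs]
      nlinarith [sq_nonneg (|c k * y| - 1)]
    rw [Real.norm_eq_abs, mul_div_assoc, abs_mul, abs_of_nonneg (hc k)]
    exact mul_le_of_le_one_right (hc k) h1

lemma continuous_phase (hc : ∀ k, 0 ≤ c k) (hs : Summable c) : Continuous (phase c) :=
  continuous_iff_continuousAt.2 fun x => (hasDerivAt_phase hc hs x).continuousAt

lemma phaseDeriv_pos (hc : ∀ k, 0 ≤ c k) (hs : Summable c) (h0 : 0 < c 0) (x : ℝ) :
    0 < phaseDeriv c x :=
  (summable_phaseDeriv hc hs x).tsum_pos (phaseDeriv_term_nonneg hc x) 0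
    (div_pos h0 (by positivity))

lemma strictMono_phase (hc : ∀ k, 0 ≤ c k) (hs : Summable c) (h0 : 0 < c 0) :
    StrictMono (phase c) :=
  strictMono_of_deriv_pos fun x => by
    rw [(hasDerivAt_phase hc hs x).deriv]
    exact phaseDeriv_pos hc hs h0 x

lemma phase_zero (c : ℕ → ℝ) : phase c 0 = 0 := by simp [phase]

lemma one_add_mul_I_eq_exp (y : ℝ) :
    1 + Complex.I * y = Complex.exp ((Real.log (1 + y ^ 2) / 2 : ℝ) + (Real.arctan y : ℝ) * Complex.I) := by
  have h0 : 0 < 1 + y ^ 2 := by positivity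
  have h1 : Real.exp (Real.log (1 + y ^ 2) / 2) = √(1 + y ^ 2) := by
    rw [Real.exp_half, Real.exp_log h0]
  have h2 : √(1 + y ^ 2) ≠ 0 := (Real.sqrt_pos.2 h0).ne'
  rw [Complex.exp_add, ← Complex.ofReal_exp, h1, Complex.exp_mul_I, ← Complex.ofReal_cos,
    ← Complex.ofReal_sin, Real.cos_arctan, Real.sin_arctan]
  have h3 : (√(1 + y ^ 2) : ℂ) ≠ 0 := by exact_mod_cast h2
  push_cast
  field_simp

/-- Summing the arctangents of the factors, instead of taking the argument of the product, gives an
argument that is continuous in `x`; zeros can then be counted by its values. -/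
lemma hasProd_one_add_mul_I (hc : ∀ k, 0 ≤ c k) (hs : Summable c) (x : ℝ) :
    HasProd (fun k => 1 + Complex.I * (c k * x : ℝ))
      (Complex.exp (logMod c x + phase c x * Complex.I)) := by
  have h1 := (Complex.hasSum_ofReal.2 (summable_logMod hc hs x).hasSum).add
    ((Complex.hasSum_ofReal.2 (summable_phase hc hs x).hasSum).mul_right Complex.I)
  refine h1.cexp.congr_fun fun k => ?_
  exact one_add_mul_I_eq_exp _

/-- At a zero the summand containing the derivative of `logMod` drops out, so only the existence of
that derivative matters. -/
lemma hasDerivAt_expMul_sin (hc : ∀ k, 0 ≤ c k) (hs : Summable c) {x : ℝ}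
    (h : Real.sin (phase c x) = 0) :
    HasDerivAt (fun x => Real.exp (logMod c x) * Real.sin (phase c x))
      (Real.exp (logMod c x) * phaseDeriv c x * Real.cos (phase c x)) x := by
  obtain ⟨d, hd⟩ := exists_hasDerivAt_logMod hc hs x
  exact (hd.exp.mul (hasDerivAt_phase hc hs x).sin).congr_deriv (by rw [h]; ring)

lemma hasDerivAt_expMul_cos (hc : ∀ k, 0 ≤ c k) (hs : Summable c) {x : ℝ}
    (h : Real.cos (phase c x) = 0) :
    HasDerivAt (fun x => Real.exp (logMod c x) * Real.cos (phase c x))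
      (-(Real.exp (logMod c x) * phaseDeriv c x * Real.sin (phase c x))) x := by
  obtain ⟨d, hd⟩ := exists_hasDerivAt_logMod hc hs x
  exact (hd.exp.mul (hasDerivAt_phase hc hs x).cos).congr_deriv (by rw [h]; ring)

/-- `exp (logMod)` dominates every power. -/
lemma prod_mul_pow_le_exp_logMod (hc : ∀ k, 0 ≤ c k) (hs : Summable c) (K : ℕ) {x : ℝ}
    (hx : 0 ≤ x) : (∏ k ∈ Finset.range K, c k) * x ^ K ≤ Real.exp (logMod c x) := by
  have h1 : ∑ k ∈ Finset.range K, Real.log (1 + (c k * x) ^ 2) / 2 ≤ logMod c x :=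
    (summable_logMod hc hs x).sum_le_tsum _ fun k _ => half_log_one_add_sq_nonneg _
  refine le_trans ?_ (Real.exp_le_exp.2 h1)
  rw [Real.exp_sum, ← Finset.card_range K, ← Finset.prod_const, Finset.card_range,
    ← Finset.prod_mul_distrib]
  refine Finset.prod_le_prod (fun k _ => mul_nonneg (hc k) hx) fun k _ => ?_
  rw [Real.exp_half, Real.exp_log (by positivity)]
  exact Real.le_sqrt_of_sq_le (by linarith)

end Phase

/-! ### Zeros of `Sin_q` and `Cos_q` as level points of the phase -/

/-- The weights `c_k = (1 - q) q^k` of the product that defines `E_q`. -/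
noncomputable def qWeight (q : ℝ) (k : ℕ) : ℝ := (1 - q) * q ^ k

section

variable {q : ℝ}

lemma qWeight_pos (hq0 : 0 < q) (hq1 : q < 1) (k : ℕ) : 0 < qWeight q k :=
  mul_pos (by linarith) (pow_pos hq0 k)

lemma qWeight_nonneg (hq0 : 0 < q) (hq1 : q < 1) (k : ℕ) : 0 ≤ qWeight q k :=
  (qWeight_pos hq0 hq1 k).le

lemma hasSum_qWeight (hq0 : 0 < q) (hq1 : q < 1) : HasSum (qWeight q) 1 := by
  have := (hasSum_geometric_of_lt_one hq0.le hq1).mul_left (1 - q)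
  rwa [mul_inv_cancel₀ (by linarith)] at this

lemma phase_neg (c : ℕ → ℝ) (x : ℝ) : phase c (-x) = -phase c x := by
  simp [phase, tsum_neg]

lemma logMod_neg (c : ℕ → ℝ) (x : ℝ) : logMod c (-x) = logMod c x := by
  simp [logMod]

lemma bigQExp_I_mul (hq0 : 0 < q) (hq1 : q < 1) (x : ℝ) :
    bigQExp q (Complex.I * x) =
      Complex.exp (logMod (qWeight q) x + phase (qWeight q) x * Complex.I) := by
  rw [← (hasProd_one_add_mul_I (qWeight_nonneg hq0 hq1) (hasSum_qWeight hq0 hq1).summable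
    x).tprod_eq]
  refine tprod_congr fun k => ?_
  simp only [qWeight]
  push_cast
  ring

lemma bigQExp_neg_I_mul (hq0 : 0 < q) (hq1 : q < 1) (x : ℝ) :
    bigQExp q (-Complex.I * x) =
      Complex.exp (logMod (qWeight q) x + -phase (qWeight q) x * Complex.I) := by
  have := bigQExp_I_mul hq0 hq1 (-x)
  rw [phase_neg, logMod_neg] at this
  convert this using 2
  · push_cast; ring
  · push_cast; ring

lemma qSin_ofReal (hq0 : 0 < q) (hq1 : q < 1) (x : ℝ) :
    qSin q x = (Real.exp (logMod (qWeight q) x) * Real.sin (phase (qWeight q) x) : ℝ) := by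
  rw [qSin, bigQExp_I_mul hq0 hq1, bigQExp_neg_I_mul hq0 hq1, Complex.exp_add, Complex.exp_add, Complex.exp_mul_I, Complex.exp_mul_I]
  push_cast
  rw [Complex.cos_neg, Complex.sin_neg]
  field_simp
  ring

lemma qCos_ofReal (hq0 : 0 < q) (hq1 : q < 1) (x : ℝ) :
    qCos q x = (Real.exp (logMod (qWeight q) x) * Real.cos (phase (qWeight q) x) : ℝ) := by
  rw [qCos, bigQExp_I_mul hq0 hq1, bigQExp_neg_I_mul hq0 hq1, Complex.exp_add, Complex.exp_add, Complex.exp_mul_I, Complex.exp_mul_I]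
  push_cast
  rw [Complex.cos_neg, Complex.sin_neg]
  ring

/-- The weights are geometric: dividing `x` by `q` shifts them by one index and adds one new
arctangent in front. -/
lemma phase_div (hq0 : 0 < q) (hq1 : q < 1) (x : ℝ) :
    phase (qWeight q) (x / q) = Real.arctan (qWeight q 0 * (x / q)) + phase (qWeight q) x := by
  rw [phase, (summable_phase (qWeight_nonneg hq0 hq1)
    (hasSum_qWeight hq0 hq1).summable (x / q)).tsum_eq_zero_add]
  congr 1
  refine tsum_congr fun k => ?_
  congr 1
  simp only [qWeight, pow_succ]
  field_simp

lemma phase_one_le (hq0 : 0 < q) (hq1 : q < 1) : phase (qWeight q) 1 ≤ 1 := by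
  rw [phase]
  conv_rhs => rw [← (hasSum_qWeight hq0 hq1).tsum_eq]
  refine (summable_phase (qWeight_nonneg hq0 hq1) (hasSum_qWeight hq0 hq1).summable 1).tsum_le_tsum
    (fun k => ?_) (hasSum_qWeight hq0 hq1).summable
  have := (le_abs_self _).trans (abs_arctan_le_abs (qWeight q k * 1))
  rw [mul_one] at this ⊢
  rwa [abs_of_nonneg (qWeight_nonneg hq0 hq1 k)] at this

/-- Each step from `x` to `x / q` adds one arctangent, hence less than `π / 2`. So the phase grows
only logarithmically, which forces geometric growth of the zeros. -/
lemma phase_inv_pow_le (hq0 : 0 < q) (hq1 : q < 1) (n : ℕ) :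
    phase (qWeight q) ((q ^ n)⁻¹) ≤ (n + 1) * (Real.pi / 2) := by
  induction n with
  | zero =>
    have := phase_one_le hq0 hq1
    have := Real.pi_gt_three
    simp
    linarith
  | succ n ih =>
    rw [pow_succ, mul_inv, ← div_eq_mul_inv, phase_div hq0 hq1]
    have := (Real.arctan_lt_pi_div_two (qWeight q 0 * ((q ^ n)⁻¹ / q))).le
    push_cast
    linarith

lemma inv_pow_le_of_le_phase (hq0 : 0 < q) (hq1 : q < 1) {n : ℕ} {x : ℝ}
    (h : (n + 1) * (Real.pi / 2) ≤ phase (qWeight q) x) : (q ^ n)⁻¹ ≤ x :=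
  (strictMono_phase (qWeight_nonneg hq0 hq1) (hasSum_qWeight hq0 hq1).summable
    (qWeight_pos hq0 hq1 0)).le_iff_le.1 ((phase_inv_pow_le hq0 hq1 n).trans h)

/-- A finite number of the weights already brings the phase close to `N π / 2`. -/
lemma exists_lt_phase {c : ℕ → ℝ} (hc : ∀ k, 0 ≤ c k) (hs : Summable c) {N : ℕ}
    (hN : ∀ k < N, 0 < c k) {y : ℝ} (hy : y < N * (Real.pi / 2)) :
    ∃ x, 0 < x ∧ y < phase c x := by
  have h1 : Tendsto (fun x : ℝ => ∑ k ∈ Finset.range N, Real.arctan (c k * x)) atTop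
      (𝓝 (∑ k ∈ Finset.range N, Real.pi / 2)) := by
    refine tendsto_finsetSum _ fun k hk => ?_
    have h2 : Tendsto (fun x : ℝ => c k * x) atTop atTop :=
      tendsto_id.const_mul_atTop (hN k (Finset.mem_range.1 hk))
    exact (Real.tendsto_arctan_atTop.mono_right nhdsWithin_le_nhds).comp h2
  rw [Finset.sum_const, Finset.card_range, nsmul_eq_mul] at h1
  obtain ⟨x, hx1, hx2⟩ := ((h1.eventually (lt_mem_nhds hy)).and (eventually_gt_atTop 0)).exists
  refine ⟨x, hx2, hx1.trans_le ?_⟩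
  exact (summable_phase hc hs x).sum_le_tsum _ fun k _ =>
    Real.arctan_nonneg.2 (mul_nonneg (hc k) hx2.le)

lemma exists_phase_eq {c : ℕ → ℝ} (hc : ∀ k, 0 ≤ c k) (hs : Summable c) {N : ℕ}
    (hN : ∀ k < N, 0 < c k) {y : ℝ} (hy0 : 0 < y) (hy : y < N * (Real.pi / 2)) :
    ∃ x, 0 < x ∧ phase c x = y := by
  obtain ⟨b, hb, hyb⟩ := exists_lt_phase hc hs hN hy
  obtain ⟨x, hx, hxy⟩ := intermediate_value_Ioo hb.le (continuous_phase hc hs).continuousOn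
    (show y ∈ Set.Ioo (phase c 0) (phase c b) from ⟨by rwa [phase_zero], hyb⟩)
  exact ⟨x, hx.1, hxy⟩

lemma exists_qPhase_eq (hq0 : 0 < q) (hq1 : q < 1) {y : ℝ} (hy : 0 < y) :
    ∃ x, 0 < x ∧ phase (qWeight q) x = y := by
  obtain ⟨N, hN⟩ := exists_nat_gt (y / (Real.pi / 2))
  exact exists_phase_eq (qWeight_nonneg hq0 hq1) (hasSum_qWeight hq0 hq1).summable (N := N)
    (fun k _ => qWeight_pos hq0 hq1 k) hy ((div_lt_iff₀ (by positivity)).1 hN)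

/-- Allows the recursive infima to be replaced by any explicit increasing enumeration of the zeros.
-/
lemma posZero_eq {f : ℂ → ℂ} {x : ℕ → ℝ} (hx : StrictMono x)
    (hr : Set.range x = {t : ℝ | 0 < t ∧ f t = 0}) (k : ℕ) : posZero f k = x k := by
  have hmem : ∀ t : ℝ, (0 < t ∧ f (t : ℂ) = 0) ↔ ∃ j, x j = t := fun t => by
    rw [← Set.mem_range, hr]; rfl
  induction k with
  | zero =>
    refine IsLeast.csInf_eq ⟨(hmem _).2 ⟨0, rfl⟩, fun t ht => ?_⟩
    obtain ⟨j, rfl⟩ := (hmem _).1 ht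
    exact hx.monotone (Nat.zero_le j)
  | succ k ih =>
    rw [posZero, ih]
    refine IsLeast.csInf_eq ⟨⟨hx (Nat.lt_succ_self k), ((hmem _).2 ⟨k + 1, rfl⟩).2⟩,
      fun t ht => ?_⟩
    obtain ⟨j, rfl⟩ := (hmem t).1 ⟨((hmem _).2 ⟨k, rfl⟩).1.trans ht.1, ht.2⟩
    exact hx.monotone (hx.lt_iff_lt.1 ht.1)

/-- `x` lists the points where the phase equals `(k + α) π`. -/
noncomputable def IsPhaseSeq (c : ℕ → ℝ) (α : ℝ) (x : ℕ → ℝ) : Prop :=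
  ∀ k : ℕ, 0 < x k ∧ phase c (x k) = (k + α) * Real.pi

lemma exists_isPhaseSeq (hq0 : 0 < q) (hq1 : q < 1) {α : ℝ} (hα : 0 < α) :
    ∃ x, IsPhaseSeq (qWeight q) α x := by
  have h : ∀ k : ℕ, ∃ x, 0 < x ∧ phase (qWeight q) x = (k + α) * Real.pi := fun k =>
    exists_qPhase_eq hq0 hq1 (by positivity)
  choose x hx using h
  exact ⟨x, hx⟩

lemma IsPhaseSeq.strictMono (hq0 : 0 < q) (hq1 : q < 1) {α : ℝ} {x : ℕ → ℝ}
    (hx : IsPhaseSeq (qWeight q) α x) : StrictMono x := fun i j hij => by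
  rw [← (strictMono_phase (qWeight_nonneg hq0 hq1) (hasSum_qWeight hq0 hq1).summable
    (qWeight_pos hq0 hq1 0)).lt_iff_lt, (hx i).2, (hx j).2]
  have : (i : ℝ) < j := by exact_mod_cast hij
  have := Real.pi_pos
  gcongr

lemma IsPhaseSeq.inv_pow_le (hq0 : 0 < q) (hq1 : q < 1) {α : ℝ} (hα : 1 / 2 ≤ α) {x : ℕ → ℝ}
    (hx : IsPhaseSeq (qWeight q) α x) (k : ℕ) : (q ^ (2 * k))⁻¹ ≤ x k := by
  -- The level satisfies `(k + α) π ≥ (2k + 1) π / 2`, which is the bound on the phase at `q^(-2k)`.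
  refine inv_pow_le_of_le_phase hq0 hq1 ?_
  rw [(hx k).2]
  push_cast
  nlinarith [Real.pi_pos]

lemma phase_pos (hq0 : 0 < q) (hq1 : q < 1) {x : ℝ} (hx : 0 < x) : 0 < phase (qWeight q) x := by
  rw [← phase_zero (qWeight q)]
  exact strictMono_phase (qWeight_nonneg hq0 hq1) (hasSum_qWeight hq0 hq1).summable
    (qWeight_pos hq0 hq1 0) hx

lemma sin_add_one_mul_pi (k : ℕ) : Real.sin ((k + 1) * Real.pi) = 0 := by
  exact_mod_cast Real.sin_nat_mul_pi (k + 1)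

lemma cos_add_one_mul_pi (k : ℕ) : Real.cos ((k + 1) * Real.pi) = (-1) ^ (k + 1) := by
  exact_mod_cast Real.cos_nat_mul_pi (k + 1)

lemma sin_add_half_mul_pi (k : ℕ) : Real.sin ((k + 1 / 2) * Real.pi) = (-1) ^ k := by
  rw [show ((k : ℝ) + 1 / 2) * Real.pi = k * Real.pi + Real.pi / 2 by ring,
    Real.sin_add_pi_div_two, Real.cos_nat_mul_pi]

lemma cos_add_half_mul_pi (k : ℕ) : Real.cos ((k + 1 / 2) * Real.pi) = 0 := by
  rw [show ((k : ℝ) + 1 / 2) * Real.pi = k * Real.pi + Real.pi / 2 by ring,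
    Real.cos_add_pi_div_two, Real.sin_nat_mul_pi, neg_zero]

lemma IsPhaseSeq.range_qSin (hq0 : 0 < q) (hq1 : q < 1) {x : ℕ → ℝ}
    (hx : IsPhaseSeq (qWeight q) 1 x) : Set.range x = {t : ℝ | 0 < t ∧ qSin q t = 0} := by
  ext t
  simp only [Set.mem_range, Set.mem_ofPred_eq, qSin_ofReal hq0 hq1, Complex.ofReal_eq_zero,
    mul_eq_zero, (Real.exp_pos _).ne', false_or]
  constructor
  · rintro ⟨k, rfl⟩
    exact ⟨(hx k).1, by rw [(hx k).2, sin_add_one_mul_pi]⟩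
  · rintro ⟨ht, h⟩
    obtain ⟨n, hn⟩ := Real.sin_eq_zero_iff.1 h
    have h0 := phase_pos hq0 hq1 ht
    rw [← hn] at h0
    have hn0 : 0 < n := by exact_mod_cast (pos_iff_pos_of_mul_pos h0).2 Real.pi_pos
    obtain ⟨k, rfl⟩ : ∃ k : ℕ, n = k + 1 := ⟨(n - 1).toNat, by omega⟩
    refine ⟨k, (strictMono_phase (qWeight_nonneg hq0 hq1) (hasSum_qWeight hq0 hq1).summable
      (qWeight_pos hq0 hq1 0)).injective ?_⟩
    rw [(hx k).2, ← hn]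
    push_cast
    ring

lemma IsPhaseSeq.range_qCos (hq0 : 0 < q) (hq1 : q < 1) {x : ℕ → ℝ}
    (hx : IsPhaseSeq (qWeight q) (1 / 2) x) : Set.range x = {t : ℝ | 0 < t ∧ qCos q t = 0} := by
  ext t
  simp only [Set.mem_range, Set.mem_ofPred_eq, qCos_ofReal hq0 hq1, Complex.ofReal_eq_zero,
    mul_eq_zero, (Real.exp_pos _).ne', false_or]
  constructor
  · rintro ⟨k, rfl⟩
    exact ⟨(hx k).1, by rw [(hx k).2, cos_add_half_mul_pi]⟩
  · rintro ⟨ht, h⟩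
    obtain ⟨n, hn⟩ := Real.cos_eq_zero_iff.1 h
    have h0 := phase_pos hq0 hq1 ht
    rw [hn] at h0
    have hn0 : 0 < 2 * n + 1 := by
      have : (0 : ℝ) < 2 * n + 1 := by
        by_contra hneg
        nlinarith [Real.pi_pos]
      exact_mod_cast this
    obtain ⟨k, rfl⟩ : ∃ k : ℕ, n = k := ⟨n.toNat, by omega⟩
    refine ⟨k, (strictMono_phase (qWeight_nonneg hq0 hq1) (hasSum_qWeight hq0 hq1).summable
      (qWeight_pos hq0 hq1 0)).injective ?_⟩
    rw [(hx k).2, hn]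
    push_cast
    ring

lemma isPhaseSeq_sinZero (hq0 : 0 < q) (hq1 : q < 1) :
    IsPhaseSeq (qWeight q) 1 (sinZero q) := by
  obtain ⟨x, hx⟩ := exists_isPhaseSeq hq0 hq1 one_pos
  have : sinZero q = x := funext (posZero_eq (hx.strictMono hq0 hq1) (hx.range_qSin hq0 hq1))
  rwa [this]

lemma isPhaseSeq_cosZero (hq0 : 0 < q) (hq1 : q < 1) :
    IsPhaseSeq (qWeight q) (1 / 2) (cosZero q) := by
  obtain ⟨x, hx⟩ := exists_isPhaseSeq hq0 hq1 one_half_pos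
  have : cosZero q = x := funext (posZero_eq (hx.strictMono hq0 hq1) (hx.range_qCos hq0 hq1))
  rwa [this]

end

/-! ### Power series of `E_q`, `Cos_q` and `Sin_q` -/

/-- The coefficients of the power series of `E_q`. -/
noncomputable def qExpCoeff (q : ℝ) (n : ℕ) : ℝ := q ^ (n * (n - 1) / 2) / qFact q n

section

variable {q : ℝ}

lemma qNumber_pos (hq0 : 0 < q) (hq1 : q < 1) (n : ℕ) : 0 < qNumber q (n + 1) :=
  div_pos (by linarith [pow_lt_one₀ hq0.le hq1 (show n + 1 ≠ 0 by omega)]) (by linarith)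

lemma qFact_pos (hq0 : 0 < q) (hq1 : q < 1) (n : ℕ) : 0 < qFact q n :=
  Finset.prod_pos fun i _ => qNumber_pos hq0 hq1 i

lemma qExpCoeff_pos (hq0 : 0 < q) (hq1 : q < 1) (n : ℕ) : 0 < qExpCoeff q n :=
  div_pos (pow_pos hq0 _) (qFact_pos hq0 hq1 n)

lemma qExpCoeff_zero (q : ℝ) : qExpCoeff q 0 = 1 := by simp [qExpCoeff, qFact]

lemma qExpCoeff_succ (q : ℝ) (n : ℕ) :
    qExpCoeff q (n + 1) = qExpCoeff q n * (q ^ n / qNumber q (n + 1)) := by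
  have h : (n + 1) * (n + 1 - 1) / 2 = n * (n - 1) / 2 + n := by
    rw [← Finset.sum_range_id_mul_two, ← Finset.sum_range_id_mul_two, Finset.sum_range_succ]
    omega
  rw [qExpCoeff, qExpCoeff, h, qFact, Finset.prod_range_succ, ← qFact, pow_add]
  ring

/-- The coefficient form of the functional equation `E(z) = (1 + (1 - q) z) E(q z)`. -/
lemma qExpCoeff_succ_mul (hq0 : 0 < q) (hq1 : q < 1) (n : ℕ) :
    qExpCoeff q (n + 1) * (1 - q ^ (n + 1)) = (1 - q) * q ^ n * qExpCoeff q n := by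
  have h1 : 1 - q ≠ 0 := by linarith
  have h2 : 1 - q ^ (n + 1) ≠ 0 := by linarith [pow_lt_one₀ hq0.le hq1 (show n + 1 ≠ 0 by omega)]
  rw [qExpCoeff_succ, qNumber]
  field_simp

lemma summable_qExpCoeff_mul_pow (hq0 : 0 < q) (hq1 : q < 1) {r : ℝ} (hr : 0 ≤ r) :
    Summable fun n => qExpCoeff q n * r ^ n := by
  rcases hr.eq_or_lt with rfl | hr
  · exact summable_of_ne_finset_zero (s := {0}) fun n hn => by
      simp [zero_pow (show n ≠ 0 by simpa using hn)]
  refine summable_of_ratio_test_tendsto_lt_one (l := 0) one_pos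
    (.of_forall fun n => (mul_pos (qExpCoeff_pos hq0 hq1 n) (pow_pos hr n)).ne') ?_
  have h1 : Tendsto (fun n : ℕ => q ^ n * r) atTop (𝓝 0) := by
    simpa using (tendsto_pow_atTop_nhds_zero_of_lt_one hq0.le hq1).mul_const r
  refine squeeze_zero (fun n => by positivity) (fun n => ?_) h1
  have ha := qExpCoeff_pos hq0 hq1 n
  have hb := qNumber_pos hq0 hq1 n
  have hb1 : 1 ≤ qNumber q (n + 1) := by
    rw [qNumber, one_le_div (by linarith)]
    linarith [pow_le_of_le_one hq0.le hq1.le (show n + 1 ≠ 0 by omega)]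
  rw [Real.norm_of_nonneg (mul_pos (qExpCoeff_pos hq0 hq1 _) (pow_pos hr _)).le,
    Real.norm_of_nonneg (mul_pos ha (pow_pos hr _)).le, qExpCoeff_succ, pow_succ r]
  have : qExpCoeff q n * (q ^ n / qNumber q (n + 1)) * (r ^ n * r) / (qExpCoeff q n * r ^ n)
      = q ^ n * r / qNumber q (n + 1) := by
    field_simp
  rw [this]
  exact div_le_self (by positivity) hb1

lemma summable_qExpCoeff_mul_pow_complex (hq0 : 0 < q) (hq1 : q < 1) (z : ℂ) :
    Summable fun n => (qExpCoeff q n : ℂ) * z ^ n := by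
  refine Summable.of_norm_bounded (summable_qExpCoeff_mul_pow hq0 hq1 (norm_nonneg z)) fun n => ?_
  rw [norm_mul, norm_pow, Complex.norm_of_nonneg (qExpCoeff_pos hq0 hq1 n).le]

lemma differentiable_tsum_qExpCoeff (hq0 : 0 < q) (hq1 : q < 1) :
    Differentiable ℂ fun z : ℂ => ∑' n, (qExpCoeff q n : ℂ) * z ^ n := fun z => by
  have h := Complex.differentiableOn_tsum_of_summable_norm
    (F := fun n (z : ℂ) => (qExpCoeff q n : ℂ) * z ^ n) (U := Metric.ball 0 (‖z‖ + 1))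
    (summable_qExpCoeff_mul_pow hq0 hq1 (show 0 ≤ ‖z‖ + 1 by positivity))
    (fun n => by fun_prop) Metric.isOpen_ball fun n w hw => by
      rw [norm_mul, norm_pow, Complex.norm_of_nonneg (qExpCoeff_pos hq0 hq1 n).le]
      have := (qExpCoeff_pos hq0 hq1 n).le
      have := (mem_ball_zero_iff.1 hw).le
      gcongr
  exact h.differentiableAt (Metric.isOpen_ball.mem_nhds (by simp))

lemma tsum_qExpCoeff_functional (hq0 : 0 < q) (hq1 : q < 1) (z : ℂ) :
    ∑' n, (qExpCoeff q n : ℂ) * z ^ n =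
      (1 + (1 - q) * z) * ∑' n, (qExpCoeff q n : ℂ) * (q * z) ^ n := by
  have h1 := summable_qExpCoeff_mul_pow_complex hq0 hq1 z
  have h2 := summable_qExpCoeff_mul_pow_complex hq0 hq1 (q * z)
  rw [add_mul, one_mul, h1.tsum_eq_zero_add]
  nth_rewrite 1 [h2.tsum_eq_zero_add]
  rw [add_assoc]
  rw [pow_zero, pow_zero]
  congr 1
  rw [← tsum_mul_left, ← ((summable_nat_add_iff 1).2 h2).tsum_add (h2.mul_left _)]
  refine tsum_congr fun n => ?_
  have h3 : (qExpCoeff q (n + 1) : ℂ) * (1 - q ^ (n + 1)) = (1 - q) * q ^ n * qExpCoeff q n := by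
    exact_mod_cast qExpCoeff_succ_mul hq0 hq1 n
  linear_combination z ^ (n + 1) * h3

lemma tsum_qExpCoeff_eq_prod (hq0 : 0 < q) (hq1 : q < 1) (z : ℂ) (N : ℕ) :
    ∑' n, (qExpCoeff q n : ℂ) * z ^ n =
      (∏ k ∈ Finset.range N, (1 - (-(1 - (q : ℂ)) * z) * q ^ k)) *
        ∑' n, (qExpCoeff q n : ℂ) * (q ^ N * z) ^ n := by
  induction N with
  | zero => simp
  | succ N ih =>
    rw [ih, tsum_qExpCoeff_functional hq0 hq1 (q ^ N * z), Finset.prod_range_succ, ← mul_assoc,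
      ← mul_assoc (q : ℂ), ← pow_succ']
    ring

lemma summable_norm_qFactor (hq0 : 0 < q) (hq1 : q < 1) (z : ℂ) :
    Summable fun k : ℕ => ‖-((-(1 - (q : ℂ)) * z) * q ^ k)‖ := by
  have h := (summable_geometric_of_lt_one hq0.le hq1).mul_left ‖-(1 - (q : ℂ)) * z‖
  refine h.congr fun k => ?_
  rw [norm_neg, norm_mul _ ((q : ℂ) ^ k), norm_pow, Complex.norm_of_nonneg hq0.le]

lemma multipliable_qFactor (hq0 : 0 < q) (hq1 : q < 1) (z : ℂ) :
    Multipliable fun k : ℕ => 1 - (-(1 - (q : ℂ)) * z) * q ^ k := by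
  simpa only [sub_eq_add_neg] using
    multipliable_one_add_of_summable (summable_norm_qFactor hq0 hq1 z)

/-- Iterating the functional equation `N` times splits off the first `N` factors of the product;
what remains is the series at `q^N z`, which tends to its value 1 at 0. -/
lemma bigQExp_eq_tsum (hq0 : 0 < q) (hq1 : q < 1) (z : ℂ) :
    bigQExp q z = ∑' n, (qExpCoeff q n : ℂ) * z ^ n := by
  have h2 : Tendsto (fun N : ℕ => (q : ℂ) ^ N * z) atTop (𝓝 0) := by
    have : ‖(q : ℂ)‖ < 1 := by rwa [Complex.norm_of_nonneg hq0.le]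
    simpa using (tendsto_pow_atTop_nhds_zero_of_norm_lt_one this).mul_const z
  have h3 := (multipliable_qFactor hq0 hq1 z).hasProd.tendsto_prod_nat.mul
    ((differentiable_tsum_qExpCoeff hq0 hq1).continuous.tendsto 0 |>.comp h2)
  have h4 : ∑' n, (qExpCoeff q n : ℂ) * (0 : ℂ) ^ n = 1 := by
    rw [tsum_eq_single 0 fun n hn => by simp [hn]]
    simp [qExpCoeff_zero]
  rw [h4, mul_one] at h3
  refine tendsto_nhds_unique h3 ?_
  simp only [Function.comp_def, ← tsum_qExpCoeff_eq_prod hq0 hq1]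
  exact tendsto_const_nhds

lemma hasSum_bigQExp (hq0 : 0 < q) (hq1 : q < 1) (z : ℂ) :
    HasSum (fun n => (qExpCoeff q n : ℂ) * z ^ n) (bigQExp q z) := by
  rw [bigQExp_eq_tsum hq0 hq1]
  exact (summable_qExpCoeff_mul_pow_complex hq0 hq1 z).hasSum

lemma differentiable_bigQExp (hq0 : 0 < q) (hq1 : q < 1) : Differentiable ℂ (bigQExp q) := by
  rw [funext (bigQExp_eq_tsum hq0 hq1)]
  exact differentiable_tsum_qExpCoeff hq0 hq1

lemma hasSum_qCos (hq0 : 0 < q) (hq1 : q < 1) (z : ℂ) :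
    HasSum (fun j : ℕ => (-1) ^ j * (qExpCoeff q (2 * j) : ℂ) * z ^ (2 * j)) (qCos q z) := by
  have h := ((hasSum_bigQExp hq0 hq1 (Complex.I * z)).add
    (hasSum_bigQExp hq0 hq1 (-Complex.I * z))).div_const 2
  rw [← qCos] at h
  refine ((mul_right_injective₀ (two_ne_zero' ℕ)).hasSum_iff (fun n hn => ?_)).2 h |>.congr_fun ?_
  · have hn : Odd n := by
      rw [← Nat.not_even_iff_odd]
      rintro ⟨j, rfl⟩
      exact hn ⟨j, by simp; ring⟩
    rw [neg_mul, hn.neg_pow]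
    ring
  · intro j
    have : Complex.I ^ (2 * j) = (-1) ^ j := by rw [pow_mul, Complex.I_sq]
    simp only [Function.comp_apply, mul_pow, neg_mul, (even_two_mul j).neg_pow, this]
    ring

lemma hasSum_qSin (hq0 : 0 < q) (hq1 : q < 1) (z : ℂ) :
    HasSum (fun j : ℕ => (-1) ^ j * (qExpCoeff q (2 * j + 1) : ℂ) * z ^ (2 * j + 1))
      (qSin q z) := by
  have h := ((hasSum_bigQExp hq0 hq1 (Complex.I * z)).sub
    (hasSum_bigQExp hq0 hq1 (-Complex.I * z))).div_const (2 * Complex.I)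
  rw [← qSin] at h
  have hinj : Function.Injective fun j : ℕ => 2 * j + 1 := fun i j hij => by
    simpa using hij
  refine (hinj.hasSum_iff (fun n hn => ?_)).2 h |>.congr_fun ?_
  · have hn : Even n := by
      rw [← Nat.not_odd_iff_even]
      rintro ⟨j, rfl⟩
      exact hn ⟨j, rfl⟩
    rw [neg_mul, hn.neg_pow]
    ring
  · intro j
    have : Complex.I ^ (2 * j) = (-1) ^ j := by rw [pow_mul, Complex.I_sq]
    simp only [Function.comp_apply, mul_pow, neg_mul, (odd_two_mul_add_one j).neg_pow]
    rw [pow_succ Complex.I, this]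
    field_simp
    ring

lemma differentiable_qSin (hq0 : 0 < q) (hq1 : q < 1) : Differentiable ℂ (qSin q) := by
  have := differentiable_bigQExp hq0 hq1
  unfold qSin
  fun_prop

lemma differentiable_qCos (hq0 : 0 < q) (hq1 : q < 1) : Differentiable ℂ (qCos q) := by
  have := differentiable_bigQExp hq0 hq1
  unfold qCos
  fun_prop

/-! ### Derivatives at the zeros and simplicity -/

lemma deriv_eq_ofReal {f : ℂ → ℂ} {g : ℝ → ℝ} {g' x : ℝ} (hf : DifferentiableAt ℂ f x)
    (hfg : ∀ t : ℝ, f t = g t) (hg : HasDerivAt g g' x) : deriv f x = g' := by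
  have h1 := hf.hasDerivAt.comp_ofReal
  simp only [hfg] at h1
  exact h1.unique hg.ofReal_comp

/-- The factor `exp (logMod) * phaseDeriv`, the absolute value of the derivative at a zero. -/
noncomputable def zeroWeight (c : ℕ → ℝ) (x : ℝ) : ℝ := Real.exp (logMod c x) * phaseDeriv c x

lemma deriv_qSin_sinZero (hq0 : 0 < q) (hq1 : q < 1) (k : ℕ) :
    deriv (qSin q) (sinZero q k) = ((-1) ^ (k + 1) * zeroWeight (qWeight q) (sinZero q k) : ℝ) := by
  have h := (isPhaseSeq_sinZero hq0 hq1 k).2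
  rw [deriv_eq_ofReal (differentiable_qSin hq0 hq1 _) (qSin_ofReal hq0 hq1)
    (hasDerivAt_expMul_sin (qWeight_nonneg hq0 hq1) (hasSum_qWeight hq0 hq1).summable
      (by rw [h, sin_add_one_mul_pi])), h, cos_add_one_mul_pi, mul_comm, zeroWeight]

lemma deriv_qCos_cosZero (hq0 : 0 < q) (hq1 : q < 1) (k : ℕ) :
    deriv (qCos q) (cosZero q k) = ((-1) ^ (k + 1) * zeroWeight (qWeight q) (cosZero q k) : ℝ) := by
  have h := (isPhaseSeq_cosZero hq0 hq1 k).2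
  rw [deriv_eq_ofReal (differentiable_qCos hq0 hq1 _) (qCos_ofReal hq0 hq1)
    (hasDerivAt_expMul_cos (qWeight_nonneg hq0 hq1) (hasSum_qWeight hq0 hq1).summable
      (by rw [h, cos_add_half_mul_pi])), h, sin_add_half_mul_pi, zeroWeight]
  congr 1
  ring

lemma zeroWeight_pos (hq0 : 0 < q) (hq1 : q < 1) (x : ℝ) : 0 < zeroWeight (qWeight q) x :=
  mul_pos (Real.exp_pos _) (phaseDeriv_pos (qWeight_nonneg hq0 hq1)
    (hasSum_qWeight hq0 hq1).summable (qWeight_pos hq0 hq1 0) x)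

lemma listsSimplePosZeros_qSin (hq0 : 0 < q) (hq1 : q < 1) :
    ListsSimplePosZeros (qSin q) (sinZero q) := by
  have h := isPhaseSeq_sinZero hq0 hq1
  refine ⟨h.strictMono hq0 hq1, h.range_qSin hq0 hq1, fun k => ?_⟩
  rw [deriv_qSin_sinZero hq0 hq1, Complex.ofReal_ne_zero]
  exact mul_ne_zero (by simp) (zeroWeight_pos hq0 hq1 _).ne'

lemma listsSimplePosZeros_qCos (hq0 : 0 < q) (hq1 : q < 1) :
    ListsSimplePosZeros (qCos q) (cosZero q) := by
  have h := isPhaseSeq_cosZero hq0 hq1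
  refine ⟨h.strictMono hq0 hq1, h.range_qCos hq0 hq1, fun k => ?_⟩
  rw [deriv_qCos_cosZero hq0 hq1, Complex.ofReal_ne_zero]
  exact mul_ne_zero (by simp) (zeroWeight_pos hq0 hq1 _).ne'

end

/-! ### Growth estimates and absolute convergence -/

section

variable {q : ℝ}

/-- `exp (logMod)` dominates `x^K`, while the zeroth term alone keeps `phaseDeriv` above `c 0 / (2
x²)`. The constant involves only `c 0` and the first `K` weights, so it is unaffected by a later
truncation. -/
lemma zeroWeight_mul_sq_ge {c : ℕ → ℝ} (hc : ∀ k, 0 ≤ c k) (hs : Summable c) (h1 : c 0 ≤ 1)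
    (K : ℕ) {x : ℝ} (hx : 1 ≤ x) :
    (∏ k ∈ Finset.range K, c k) * c 0 / 2 * x ^ K ≤ zeroWeight c x * x ^ 2 := by
  have hx0 : 0 ≤ x := by linarith
  have h2 : c 0 / (1 + (c 0 * x) ^ 2) ≤ phaseDeriv c x :=
    (summable_phaseDeriv hc hs x).le_tsum 0 fun k _ => phaseDeriv_term_nonneg hc x k
  have h3 : c 0 / 2 ≤ phaseDeriv c x * x ^ 2 := by
    have h4 : c 0 / (2 * x ^ 2) ≤ c 0 / (1 + (c 0 * x) ^ 2) := by
      refine div_le_div_of_nonneg_left (hc 0) (by positivity) ?_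
      have h5 : c 0 * x ≤ x := mul_le_of_le_one_left hx0 h1
      have h6 : (c 0 * x) ^ 2 ≤ x ^ 2 := pow_le_pow_left₀ (mul_nonneg (hc 0) hx0) h5 2
      nlinarith
    have h5 := mul_le_mul_of_nonneg_right (h4.trans h2) (sq_nonneg x)
    refine le_trans (le_of_eq ?_) h5
    field_simp
  have h4 := mul_le_mul (prod_mul_pow_le_exp_logMod hc hs K hx0) h3 (by linarith [hc 0])
    (Real.exp_pos _).le
  calc _ = (∏ k ∈ Finset.range K, c k) * x ^ K * (c 0 / 2) := by ring
    _ ≤ _ := h4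
    _ = _ := by rw [zeroWeight]; ring

lemma IsPhaseSeq.one_le (hq0 : 0 < q) (hq1 : q < 1) {α : ℝ} (hα : 1 / 2 ≤ α) {x : ℕ → ℝ}
    (hx : IsPhaseSeq (qWeight q) α x) (k : ℕ) : 1 ≤ x k :=
  ((one_le_inv₀ (pow_pos hq0 _)).2 (pow_le_one₀ hq0.le hq1.le)).trans
    (hx.inv_pow_le hq0 hq1 hα k)

lemma IsPhaseSeq.summable_rpow (hq0 : 0 < q) (hq1 : q < 1) {α : ℝ} (hα : 1 / 2 ≤ α) {x : ℕ → ℝ}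
    (hx : IsPhaseSeq (qWeight q) α x) {t : ℝ} (ht : t < 0) : Summable fun k => x k ^ t := by
  have h1 : (q ^ 2) ^ (-t) < 1 :=
    Real.rpow_lt_one (by positivity) (pow_lt_one₀ hq0.le hq1 two_ne_zero) (by linarith)
  refine Summable.of_nonneg_of_le (fun k => Real.rpow_nonneg (hx k).1.le _) (fun k => ?_)
    (summable_geometric_of_lt_one (Real.rpow_nonneg (by positivity) _) h1)
  refine (Real.rpow_le_rpow_of_nonpos (by positivity) (hx.inv_pow_le hq0 hq1 hα k) ht.le).trans_eq ?_
  rw [Real.inv_rpow (by positivity), ← Real.rpow_neg (by positivity), pow_mul,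
    ← Real.rpow_natCast, ← Real.rpow_mul (by positivity), mul_comm, Real.rpow_mul (by positivity),
    Real.rpow_natCast]

lemma qWeight_zero_le_one (hq0 : 0 < q) : qWeight q 0 ≤ 1 := by
  simp [qWeight, hq0.le]

lemma norm_one_div_cpow {x : ℝ} (hx : 0 < x) (s : ℂ) : ‖1 / (x : ℂ) ^ s‖ = x ^ (-s.re) := by
  rw [norm_div, norm_one, Complex.norm_cpow_eq_rpow_re_of_pos hx, Real.rpow_neg hx.le, one_div]

lemma IsPhaseSeq.summable_eta (hq0 : 0 < q) (hq1 : q < 1) {α : ℝ} (hα : 1 / 2 ≤ α) {x : ℕ → ℝ}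
    (hx : IsPhaseSeq (qWeight q) α x) {w : ℕ → ℂ}
    (hw : ∀ k, ‖w k‖ = (zeroWeight (qWeight q) (x k))⁻¹) (s : ℂ) :
    Summable fun k => 1 / (x k : ℂ) ^ s * w k := by
  -- Of the three extra powers, two pay for the factor `x ^ 2` in `zeroWeight_mul_sq_ge` and one
  -- leaves the summable majorant `x⁻¹`.
  obtain ⟨K, hK⟩ := exists_nat_ge (3 - s.re)
  set D := (∏ k ∈ Finset.range K, qWeight q k) * qWeight q 0 / 2 with hD
  have hD0 : 0 < D := by
    have h1 := Finset.prod_pos (s := Finset.range K) fun k _ => qWeight_pos hq0 hq1 k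
    have h2 := qWeight_pos hq0 hq1 0
    positivity
  refine Summable.of_norm_bounded ((hx.summable_rpow hq0 hq1 hα (t := -1) (by norm_num)).mul_left
    D⁻¹) fun k => ?_
  have hx1 := hx.one_le hq0 hq1 hα k
  have hx0 := (hx k).1
  have h1 := zeroWeight_mul_sq_ge (qWeight_nonneg hq0 hq1) (hasSum_qWeight hq0 hq1).summable
    (qWeight_zero_le_one hq0) K hx1
  rw [← hD] at h1
  have hz := zeroWeight_pos hq0 hq1 (x k)
  rw [norm_mul, norm_one_div_cpow hx0, hw, ← div_eq_mul_inv, div_le_iff₀ hz]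
  have h2 : x k ^ (-s.re) ≤ x k ^ ((K : ℝ) - 3) :=
    Real.rpow_le_rpow_of_exponent_le hx1 (by linarith)
  have h3 : x k ^ ((K : ℝ) - 3) = x k ^ K / x k ^ 3 := by
    rw [Real.rpow_sub hx0, Real.rpow_natCast]
    norm_num
  have h4 : x k ^ K ≤ D⁻¹ * (zeroWeight (qWeight q) (x k) * x k ^ 2) := by
    rw [← div_eq_inv_mul, le_div_iff₀ hD0]
    linarith
  rw [h3] at h2
  refine h2.trans ?_
  rw [div_le_iff₀ (by positivity), Real.rpow_neg_one]
  refine h4.trans_eq ?_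
  field_simp

/-- A single term suffices: since the weights are geometric, some index `n + 1` has `q ^ (n + 1) *
x` between `q` and 1, and that term is already of order one. -/
lemma mul_phaseDeriv_ge (hq0 : 0 < q) (hq1 : q < 1) {x : ℝ} (hx : 1 ≤ x) :
    (1 - q) * q / 2 ≤ x * phaseDeriv (qWeight q) x := by
  have hx0 : 0 < x := by linarith
  obtain ⟨n, hn1, hn2⟩ := exists_nat_pow_near_of_lt_one (inv_pos.2 hx0) (inv_le_one_of_one_le₀ hx)
    hq0 hq1
  have h1 : qWeight q (n + 1) / (1 + (qWeight q (n + 1) * x) ^ 2) ≤ phaseDeriv (qWeight q) x :=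
    (summable_phaseDeriv (qWeight_nonneg hq0 hq1) (hasSum_qWeight hq0 hq1).summable x).le_tsum _
      fun k _ => phaseDeriv_term_nonneg (qWeight_nonneg hq0 hq1) x k
  refine le_trans ?_ (mul_le_mul_of_nonneg_left h1 hx0.le)
  have h2 : q ^ (n + 1) * x ≤ 1 := by
    rw [← inv_mul_cancel₀ hx0.ne']
    exact mul_le_mul_of_nonneg_right hn1.le hx0.le
  have h3 : q ≤ q ^ (n + 1) * x := by
    have := mul_le_mul_of_nonneg_right hn2 hx0.le
    rw [inv_mul_cancel₀ hx0.ne'] at this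
    rw [pow_succ]
    nlinarith
  set y := q ^ (n + 1) * x
  have hy : qWeight q (n + 1) * x = (1 - q) * y := by rw [qWeight]; ring
  rw [← mul_div_assoc, mul_comm x, hy]
  have h4 : (1 - q) * y ≤ 1 := by nlinarith
  have h5 : 0 ≤ (1 - q) * y := mul_nonneg (by linarith) (by linarith)
  rw [div_le_div_iff₀ two_pos (by positivity)]
  have h6 : (1 - q) * q ≤ (1 - q) * y := mul_le_mul_of_nonneg_left h3 (by linarith)
  have h7 : ((1 - q) * y) ^ 2 ≤ 1 := pow_le_one₀ h5 h4
  have h8 : 0 ≤ (1 - q) * q := mul_nonneg (by linarith) hq0.le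
  nlinarith

lemma phaseDeriv_eq_add (hq0 : 0 < q) (hq1 : q < 1) (x : ℝ) :
    x * phaseDeriv (qWeight q) x = qWeight q 0 * x / (1 + (qWeight q 0 * x) ^ 2) +
      (q * x) * phaseDeriv (qWeight q) (q * x) := by
  rw [phaseDeriv, (summable_phaseDeriv (qWeight_nonneg hq0 hq1)
    (hasSum_qWeight hq0 hq1).summable x).tsum_eq_zero_add, mul_add, phaseDeriv, ← tsum_mul_left,
    ← tsum_mul_left]
  congr 1
  · ring
  · refine tsum_congr fun k => ?_
    have : qWeight q (k + 1) = qWeight q k * q := by simp [qWeight, pow_succ, mul_assoc]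
    rw [this]
    ring

/-- For `x` between `q^(-n)` and `q^(-n-1)`, split off the zeroth term. It is at most `1 / ((1 - q)
x) ≤ q^n / (1 - q)`, and the rest is the same function at `q x ≤ q^(-n)`. The errors form a
geometric series, so the bound is uniform in `n`. -/
lemma mul_phaseDeriv_le_sum (hq0 : 0 < q) (hq1 : q < 1) (n : ℕ) :
    ∀ {x : ℝ}, 0 ≤ x → x ≤ (q ^ n)⁻¹ →
      x * phaseDeriv (qWeight q) x ≤ 1 + ∑ i ∈ Finset.range n, q ^ i / (1 - q) := by
  induction n with
  | zero =>
    intro x hx0 hx1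
    have h1 : phaseDeriv (qWeight q) x ≤ 1 := by
      rw [phaseDeriv]
      conv_rhs => rw [← (hasSum_qWeight hq0 hq1).tsum_eq]
      exact (summable_phaseDeriv (qWeight_nonneg hq0 hq1) (hasSum_qWeight hq0 hq1).summable
        x).tsum_le_tsum (phaseDeriv_term_le (qWeight_nonneg hq0 hq1) x)
        (hasSum_qWeight hq0 hq1).summable
    have h2 := (phaseDeriv_pos (qWeight_nonneg hq0 hq1) (hasSum_qWeight hq0 hq1).summable
      (qWeight_pos hq0 hq1 0) x).le
    simp only [pow_zero, inv_one] at hx1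
    simpa using mul_le_one₀ hx1 h2 h1
  | succ n ih =>
    intro x hx0 hx1
    have hq' : 0 < 1 - q := by linarith
    rw [Finset.sum_range_succ, ← add_assoc]
    rcases le_or_gt x (q ^ n)⁻¹ with h | h
    · exact (ih hx0 h).trans (le_add_of_nonneg_right (by positivity))
    · rw [phaseDeriv_eq_add hq0 hq1, add_comm]
      have hxpos : 0 < x := (inv_pos.2 (pow_pos hq0 n)).trans h
      refine add_le_add (ih (by positivity) ?_) ?_
      · rw [pow_succ, mul_inv, ← div_eq_mul_inv, le_div_iff₀ hq0] at hx1
        linarith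
      · have h1 : 1 ≤ q ^ n * x := by
          rw [← mul_inv_cancel₀ (pow_pos hq0 n).ne']
          exact mul_le_mul_of_nonneg_left h.le (pow_pos hq0 n).le
        simp only [qWeight, pow_zero, mul_one]
        rw [div_le_div_iff₀ (by positivity) hq']
        have h2 : 0 ≤ (1 - q) ^ 2 * x := by positivity
        have h3 : 0 ≤ q ^ n := by positivity
        nlinarith

lemma mul_phaseDeriv_le (hq0 : 0 < q) (hq1 : q < 1) {x : ℝ} (hx : 0 < x) :
    x * phaseDeriv (qWeight q) x ≤ 1 + (1 - q)⁻¹ / (1 - q) := by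
  have h : ∃ n, x ≤ (q ^ n)⁻¹ := by
    obtain ⟨n, hn⟩ := exists_pow_lt_of_lt_one (inv_pos.2 hx) hq1
    exact ⟨n, (le_inv_comm₀ (pow_pos hq0 n) hx).1 hn.le⟩
  obtain ⟨n, hn⟩ := h
  refine (mul_phaseDeriv_le_sum hq0 hq1 n hx.le hn).trans ?_
  rw [← Finset.sum_div, ← tsum_geometric_of_lt_one hq0.le hq1]
  have := (summable_geometric_of_lt_one hq0.le hq1).sum_le_tsum (Finset.range n)
    fun k _ => (pow_pos hq0 k).le
  have hq' : 0 < 1 - q := by linarith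
  gcongr

/-- Compares a factor `1 + t` of `E_q(x)` with the modulus of the factor `1 + i t` of `E_q(ix)`: the
square of their ratio is `1 + 2t / (1 + t²)`, at most `exp (2t / (1 + t²))`. -/
lemma one_add_le_exp (t : ℝ) :
    1 + t ≤ Real.exp (Real.log (1 + t ^ 2) / 2 + t / (1 + t ^ 2)) := by
  have h1 : (1 + t) ^ 2 = (1 + t ^ 2) * (1 + 2 * (t / (1 + t ^ 2))) := by
    field_simp
    ring
  have h2 := Real.add_one_le_exp (2 * (t / (1 + t ^ 2)))
  refine le_of_sq_le_sq ?_ (Real.exp_pos _).le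
  rw [h1, ← Real.exp_nat_mul, show ((2 : ℕ) : ℝ) * (Real.log (1 + t ^ 2) / 2 + t / (1 + t ^ 2)) =
    Real.log (1 + t ^ 2) + 2 * (t / (1 + t ^ 2)) by push_cast; ring, Real.exp_add,
    Real.exp_log (by positivity)]
  gcongr
  linarith

lemma norm_bigQExp_le (hq0 : 0 < q) (hq1 : q < 1) {x : ℝ} (hx : 0 ≤ x) :
    ‖bigQExp q x‖ ≤
      Real.exp (logMod (qWeight q) x + x * phaseDeriv (qWeight q) x) := by
  have hc := qWeight_nonneg hq0 hq1
  have hs := (hasSum_qWeight hq0 hq1).summable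
  refine le_of_tendsto (multipliable_qFactor hq0 hq1 (x : ℂ)).hasProd.tendsto_prod_nat.norm
    (.of_forall fun N => ?_)
  have h1 : ∑ k ∈ Finset.range N, (Real.log (1 + (qWeight q k * x) ^ 2) / 2 +
      x * (qWeight q k / (1 + (qWeight q k * x) ^ 2))) ≤
      logMod (qWeight q) x + x * phaseDeriv (qWeight q) x := by
    rw [Finset.sum_add_distrib, ← Finset.mul_sum]
    refine add_le_add ((summable_logMod hc hs x).sum_le_tsum _ fun k _ =>
      half_log_one_add_sq_nonneg _) (mul_le_mul_of_nonneg_left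
        ((summable_phaseDeriv hc hs x).sum_le_tsum _ fun k _ => phaseDeriv_term_nonneg hc x k) hx)
  refine le_trans ?_ (Real.exp_le_exp.2 h1)
  rw [Real.exp_sum, norm_prod]
  refine Finset.prod_le_prod (fun k _ => norm_nonneg _) fun k _ => ?_
  have h2 : 1 - -(1 - (q : ℂ)) * x * q ^ k = ((1 + qWeight q k * x : ℝ) : ℂ) := by
    rw [qWeight]; push_cast; ring
  have h3 : 0 ≤ qWeight q k * x := mul_nonneg (hc k) hx
  rw [h2, Complex.norm_of_nonneg (by positivity)]
  refine (one_add_le_exp _).trans_eq ?_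
  congr 2
  ring

/-- The factorwise corrections `t / (1 + t²)` add up to at most `x φ'(x)`, which is bounded. Thus
replacing every term of the series at `i x` by its absolute value costs only a constant factor; this
makes the exchange of sums possible. -/
lemma tsum_qExpCoeff_le (hq0 : 0 < q) (hq1 : q < 1) {x : ℝ} (hx : 0 < x) :
    ∑' n, qExpCoeff q n * x ^ n ≤
      Real.exp (1 + (1 - q)⁻¹ / (1 - q)) * Real.exp (logMod (qWeight q) x) := by
  have h1 : ((∑' n, qExpCoeff q n * x ^ n : ℝ) : ℂ) = bigQExp q x := by
    rw [bigQExp_eq_tsum hq0 hq1, Complex.ofReal_tsum]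
    push_cast
    rfl
  have h2 := norm_bigQExp_le hq0 hq1 hx.le
  rw [← h1, Complex.norm_real] at h2
  refine ((le_abs_self _).trans h2).trans ?_
  rw [← Real.exp_add, Real.exp_le_exp]
  linarith [mul_phaseDeriv_le hq0 hq1 hx]

lemma IsPhaseSeq.inv_phaseDeriv_le (hq0 : 0 < q) (hq1 : q < 1) {α : ℝ} (hα : 1 / 2 ≤ α)
    {x : ℕ → ℝ} (hx : IsPhaseSeq (qWeight q) α x) (k : ℕ) :
    (phaseDeriv (qWeight q) (x k))⁻¹ ≤ ((1 - q) * q / 2)⁻¹ * x k := by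
  have h1 := mul_phaseDeriv_ge hq0 hq1 (hx.one_le hq0 hq1 hα k)
  have h2 := phaseDeriv_pos (qWeight_nonneg hq0 hq1) (hasSum_qWeight hq0 hq1).summable
      (qWeight_pos hq0 hq1 0) (x k)
  have h3 : 0 < (1 - q) * q / 2 := by
    have : 0 < 1 - q := by linarith
    positivity
  rw [inv_le_iff_one_le_mul₀ h2, mul_assoc, ← div_eq_inv_mul, one_le_div h3]
  exact h1

lemma IsPhaseSeq.summable_inv_phaseDeriv (hq0 : 0 < q) (hq1 : q < 1) {α : ℝ} (hα : 1 / 2 ≤ α)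
    {x : ℕ → ℝ} (hx : IsPhaseSeq (qWeight q) α x) {t : ℝ} (ht : 1 < t) :
    Summable fun k => (phaseDeriv (qWeight q) (x k))⁻¹ * x k ^ (-t) := by
  refine Summable.of_nonneg_of_le (fun k => ?_) (fun k => ?_)
    -- The bound `1 / φ' = O(x)` costs one power of `x`, hence the requirement `t > 1`.
    ((hx.summable_rpow hq0 hq1 hα (t := 1 - t) (by linarith)).mul_left ((1 - q) * q / 2)⁻¹)
  · exact mul_nonneg (inv_nonneg.2 (phaseDeriv_pos (qWeight_nonneg hq0 hq1)
      (hasSum_qWeight hq0 hq1).summable (qWeight_pos hq0 hq1 0) (x k)).le)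
      (Real.rpow_nonneg (hx k).1.le _)
  · refine (mul_le_mul_of_nonneg_right (hx.inv_phaseDeriv_le hq0 hq1 hα k)
      (Real.rpow_nonneg (hx k).1.le _)).trans_eq ?_
    rw [sub_eq_add_neg 1 t, Real.rpow_add (hx k).1, Real.rpow_one, mul_assoc]

lemma IsPhaseSeq.summable_zeta (hq0 : 0 < q) (hq1 : q < 1) {α : ℝ} (hα : 1 / 2 ≤ α) {x : ℕ → ℝ}
    (hx : IsPhaseSeq (qWeight q) α x) {w : ℕ → ℂ}
    (hw : ∀ k, ‖w k‖ = (phaseDeriv (qWeight q) (x k))⁻¹) {s : ℂ} (hs : 1 < s.re) :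
    Summable fun k => w k * (1 / (x k : ℂ) ^ s) := by
  refine Summable.of_norm ((hx.summable_inv_phaseDeriv hq0 hq1 hα hs).congr fun k => ?_)
  rw [norm_mul, hw, norm_one_div_cpow (hx k).1]

/-- Each row sums to at most a constant times `e^L / (e^L φ') = 1 / φ'` times `x^(-t)`, so the rows
are summable exactly as in the series for `ζ`. -/
lemma IsPhaseSeq.summable_double (hq0 : 0 < q) (hq1 : q < 1) {α : ℝ} (hα : 1 / 2 ≤ α) {x : ℕ → ℝ}
    (hx : IsPhaseSeq (qWeight q) α x) {t : ℝ} (ht : 1 < t) :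
    Summable fun p : ℕ × ℕ => qExpCoeff q p.2 * x p.1 ^ p.2 *
      ((zeroWeight (qWeight q) (x p.1))⁻¹ * x p.1 ^ (-t)) := by
  set v : ℕ → ℝ := fun k => (zeroWeight (qWeight q) (x k))⁻¹ * x k ^ (-t) with hv
  have hv0 : ∀ k, 0 ≤ v k := fun k =>
    mul_nonneg (inv_nonneg.2 (zeroWeight_pos hq0 hq1 _).le) (Real.rpow_nonneg (hx k).1.le _)
  have hnn : ∀ k n, 0 ≤ qExpCoeff q n * x k ^ n * v k := fun k n =>
    mul_nonneg (mul_nonneg (qExpCoeff_pos hq0 hq1 _).le (pow_nonneg (hx _).1.le _)) (hv0 _)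
  have hle : ∀ k, ∑' n, qExpCoeff q n * x k ^ n * v k ≤
      Real.exp (1 + (1 - q)⁻¹ / (1 - q)) * ((phaseDeriv (qWeight q) (x k))⁻¹ * x k ^ (-t)) := by
    intro k
    rw [tsum_mul_right]
    refine (mul_le_mul_of_nonneg_right (tsum_qExpCoeff_le hq0 hq1 (hx k).1) (hv0 k)).trans_eq ?_
    have h2 := (Real.exp_pos (logMod (qWeight q) (x k))).ne'
    simp only [hv]
    rw [zeroWeight, mul_inv, mul_assoc, mul_assoc _ _ (x k ^ (-t)), mul_inv_cancel_left₀ h2]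
  refine (summable_prod_of_nonneg (f := fun p : ℕ × ℕ => qExpCoeff q p.2 * x p.1 ^ p.2 * v p.1)
    fun p => hnn p.1 p.2).2 ⟨fun k => ?_, ?_⟩
  · exact (summable_qExpCoeff_mul_pow hq0 hq1 (hx k).1.le).mul_right (v k)
  · exact Summable.of_nonneg_of_le (fun k => tsum_nonneg (hnn k)) hle
      ((hx.summable_inv_phaseDeriv hq0 hq1 hα ht).mul_left _)

/-! ### Exchange of summation and the two expansions -/

lemma hasSum_tsum_columns {T : ℕ × ℕ → ℂ} (hT : Summable T) {u v : ℕ → ℂ}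
    (hu : ∀ k, ∑' j, T (k, j) = u k) (hv : ∀ j, ∑' k, T (k, j) = v j) :
    HasSum v (∑' k, u k) := by
  have h1 : HasSum (fun j => ∑' k, T (k, j)) (∑' j, ∑' k, T (k, j)) := hT.prod_symm.prod.hasSum
  rw [Summable.tsum_comm (f := fun k j => T (k, j)) hT] at h1
  rw [← funext hu, ← funext hv]
  exact h1

lemma IsPhaseSeq.summable_expansion (hq0 : 0 < q) (hq1 : q < 1) {α : ℝ} (hα : 1 / 2 ≤ α)
    {x : ℕ → ℝ} (hx : IsPhaseSeq (qWeight q) α x) {w : ℕ → ℂ}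
    (hw : ∀ k, ‖w k‖ = (zeroWeight (qWeight q) (x k))⁻¹) {g : ℕ → ℕ}
    (hg : Function.Injective g) {s : ℂ} (hs : 1 < s.re) :
    Summable fun p : ℕ × ℕ => (-1) ^ p.2 * (qExpCoeff q (g p.2) : ℂ) * (x p.1 : ℂ) ^ g p.2 *
      (w p.1 * (1 / (x p.1 : ℂ) ^ s)) := by
  -- The even or odd part of the power series is a subfamily of the full double series.
  have hinj : Function.Injective fun p : ℕ × ℕ => (p.1, g p.2) := fun a b hab =>
    Prod.ext (Prod.mk.inj hab).1 (hg (Prod.mk.inj hab).2)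
  refine Summable.of_norm_bounded ((hx.summable_double hq0 hq1 hα hs).comp_injective hinj)
    fun p => le_of_eq ?_
  rw [norm_mul, norm_mul, norm_mul, norm_mul, norm_one_div_cpow (hx _).1, hw, norm_pow, norm_pow,
    norm_neg, norm_one, one_pow, one_mul, Complex.norm_of_nonneg (qExpCoeff_pos hq0 hq1 _).le,
    Complex.norm_of_nonneg (hx _).1.le]
  rfl

/-- Summation by rows and by columns of the double series obtained by expanding `F`. -/
lemma IsPhaseSeq.hasSum_expansion (hq0 : 0 < q) (hq1 : q < 1) {α : ℝ} (hα : 1 / 2 ≤ α)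
    {x : ℕ → ℝ} (hx : IsPhaseSeq (qWeight q) α x) {w : ℕ → ℂ}
    (hw : ∀ k, ‖w k‖ = (zeroWeight (qWeight q) (x k))⁻¹) {F : ℂ → ℂ} {g : ℕ → ℕ}
    (hg : Function.Injective g)
    (hF : ∀ z, HasSum (fun j => (-1) ^ j * (qExpCoeff q (g j) : ℂ) * z ^ g j) (F z))
    {s : ℂ} (hs : 1 < s.re) :
    HasSum (fun j => (-1) ^ j * (qExpCoeff q (g j) : ℂ) *
        ∑' k, 1 / (x k : ℂ) ^ (s - (g j : ℂ)) * w k)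
      (∑' k, F (x k) * w k * (1 / (x k : ℂ) ^ s)) := by
  refine hasSum_tsum_columns (hx.summable_expansion hq0 hq1 hα hw hg hs) (fun k => ?_) fun j => ?_
  · rw [mul_assoc, ← (hF (x k)).tsum_eq, ← tsum_mul_right]
  · rw [← tsum_mul_left]
    refine tsum_congr fun k => ?_
    have h0 : (x k : ℂ) ≠ 0 := by exact_mod_cast (hx k).1.ne'
    rw [Complex.cpow_sub _ _ h0, Complex.cpow_natCast, one_div_div]
    ring

lemma norm_one_div_deriv_qSin (hq0 : 0 < q) (hq1 : q < 1) (k : ℕ) :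
    ‖1 / deriv (qSin q) (sinZero q k)‖ = (zeroWeight (qWeight q) (sinZero q k))⁻¹ := by
  rw [deriv_qSin_sinZero hq0 hq1, norm_div, norm_one, Complex.norm_real, norm_mul, norm_pow,
    norm_neg, norm_one, one_pow, one_mul, Real.norm_of_nonneg (zeroWeight_pos hq0 hq1 _).le,
    one_div]

lemma norm_one_div_deriv_qCos (hq0 : 0 < q) (hq1 : q < 1) (k : ℕ) :
    ‖1 / deriv (qCos q) (cosZero q k)‖ = (zeroWeight (qWeight q) (cosZero q k))⁻¹ := by
  rw [deriv_qCos_cosZero hq0 hq1, norm_div, norm_one, Complex.norm_real, norm_mul, norm_pow,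
    norm_neg, norm_one, one_pow, one_mul, Real.norm_of_nonneg (zeroWeight_pos hq0 hq1 _).le,
    one_div]

lemma summable_qEtaTerm (hq0 : 0 < q) (hq1 : q < 1) (s : ℂ) : Summable (qEtaTerm q s) :=
  (isPhaseSeq_sinZero hq0 hq1).summable_eta hq0 hq1 (by norm_num)
    (norm_one_div_deriv_qSin hq0 hq1) s

lemma summable_qEtaStarTerm (hq0 : 0 < q) (hq1 : q < 1) (s : ℂ) : Summable (qEtaStarTerm q s) :=
  (isPhaseSeq_cosZero hq0 hq1).summable_eta hq0 hq1 le_rfl (norm_one_div_deriv_qCos hq0 hq1) s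

/-- At a zero of `Sin_q` the cosine of the phase is `±1`, so `Cos_q` has modulus `e^L`; this cancels
against the derivative and leaves `1 / φ'`. -/
lemma summable_qZetaTerm (hq0 : 0 < q) (hq1 : q < 1) {s : ℂ} (hs : 1 < s.re) :
    Summable (qZetaTerm q s) := by
  refine (isPhaseSeq_sinZero hq0 hq1).summable_zeta hq0 hq1 (by norm_num) (fun k => ?_) hs
  rw [div_eq_mul_one_div, norm_mul, norm_one_div_deriv_qSin hq0 hq1, qCos_ofReal hq0 hq1,
    (isPhaseSeq_sinZero hq0 hq1 k).2, cos_add_one_mul_pi, Complex.norm_real, norm_mul, norm_pow,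
    norm_neg, norm_one, one_pow, mul_one, Real.norm_of_nonneg (Real.exp_pos _).le, zeroWeight,
    mul_inv, mul_inv_cancel_left₀ (Real.exp_pos _).ne']

lemma summable_qZetaStarTerm (hq0 : 0 < q) (hq1 : q < 1) {s : ℂ} (hs : 1 < s.re) :
    Summable (qZetaStarTerm q s) := by
  refine (isPhaseSeq_cosZero hq0 hq1).summable_zeta hq0 hq1 le_rfl (fun k => ?_) hs
  rw [div_eq_mul_one_div, norm_mul, norm_one_div_deriv_qCos hq0 hq1, qSin_ofReal hq0 hq1,
    (isPhaseSeq_cosZero hq0 hq1 k).2, sin_add_half_mul_pi, Complex.norm_real, norm_mul, norm_pow,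
    norm_neg, norm_one, one_pow, mul_one, Real.norm_of_nonneg (Real.exp_pos _).le, zeroWeight,
    mul_inv, mul_inv_cancel_left₀ (Real.exp_pos _).ne']

/-- At `j = 0` the truncated subtraction in `2 * j - 1` is harmless, because the exponent carries
the factor `j`. -/
lemma ofReal_qExpCoeff_even (q : ℝ) (j : ℕ) :
    (qExpCoeff q (2 * j) : ℂ) = (q : ℂ) ^ (j * (2 * j - 1)) / (qFact q (2 * j) : ℂ) := by
  rw [qExpCoeff, mul_assoc, Nat.mul_div_cancel_left _ two_pos]
  push_cast
  rfl

lemma ofReal_qExpCoeff_odd (q : ℝ) (j : ℕ) :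
    (qExpCoeff q (2 * j + 1) : ℂ) = (q : ℂ) ^ (j * (2 * j + 1)) / (qFact q (2 * j + 1) : ℂ) := by
  rw [qExpCoeff, Nat.add_sub_cancel, mul_left_comm, Nat.mul_div_cancel_left _ two_pos, mul_comm j]
  push_cast
  rfl

lemma hasSum_qZeta (hq0 : 0 < q) (hq1 : q < 1) {s : ℂ} (hs : 1 < s.re) :
    HasSum (fun j : ℕ =>
      (-1 : ℂ) ^ (j + 1) / (qFact q (2 * j) : ℂ) * (q : ℂ) ^ (j * (2 * j - 1)) *
        qEta q (s - 2 * (j : ℂ))) (qZeta q s) := by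
  have h := (isPhaseSeq_sinZero hq0 hq1).hasSum_expansion hq0 hq1 (by norm_num)
    (norm_one_div_deriv_qSin hq0 hq1) (mul_right_injective₀ (two_ne_zero' ℕ)) (hasSum_qCos hq0 hq1)
    hs
  convert h using 1
  · funext j
    -- The minus sign in `qEta` turns `(-1) ^ j` into `(-1) ^ (j + 1)`.
    rw [ofReal_qExpCoeff_even, qEta]
    simp only [qEtaTerm]
    push_cast
    ring
  · simp only [qZeta, qZetaTerm, div_eq_mul_one_div (qCos q _)]

lemma hasSum_qZetaStar (hq0 : 0 < q) (hq1 : q < 1) {s : ℂ} (hs : 1 < s.re) :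
    HasSum (fun j : ℕ =>
      (-1 : ℂ) ^ j / (qFact q (2 * j + 1) : ℂ) * (q : ℂ) ^ (j * (2 * j + 1)) *
        qEtaStar q (s - 2 * (j : ℂ) - 1)) (qZetaStar q s) := by
  have h := ((isPhaseSeq_cosZero hq0 hq1).hasSum_expansion hq0 hq1 le_rfl
    (norm_one_div_deriv_qCos hq0 hq1) (g := fun j => 2 * j + 1)
    (fun i j hij => by simpa using hij) (hasSum_qSin hq0 hq1) hs).neg
  have h1 : qZetaStar q s = -∑' k, qSin q (cosZero q k) * (1 / deriv (qCos q) (cosZero q k)) *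
      (1 / (cosZero q k : ℂ) ^ s) := by
    simp only [qZetaStar, qZetaStarTerm, div_eq_mul_one_div (qSin q _)]
  rw [h1]
  refine h.congr_fun fun j => ?_
  -- Here the minus signs in `qZetaStar` and `qEtaStar` cancel.
  rw [ofReal_qExpCoeff_odd, qEtaStar]
  simp only [qEtaStarTerm]
  push_cast
  rw [sub_sub]
  ring

end

/-! ### Truncated products and Euler's identity -/

/-- The sequence `c` cut off after its first `N` terms. -/
noncomputable def truncSeq (c : ℕ → ℝ) (N k : ℕ) : ℝ := if k < N then c k else 0

/-- The polynomials `A`, `B` with `∏_{k < n} (1 + i c_k x) = A(x²) + i x B(x²)`. -/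
noncomputable def cosSinPoly (c : ℕ → ℝ) : ℕ → Polynomial ℝ × Polynomial ℝ
  | 0 => (1, 0)
  | n + 1 => ((cosSinPoly c n).1 - Polynomial.C (c n) * Polynomial.X * (cosSinPoly c n).2,
      (cosSinPoly c n).2 + Polynomial.C (c n) * (cosSinPoly c n).1)

section

variable {c : ℕ → ℝ}

lemma truncSeq_nonneg (hc : ∀ k, 0 ≤ c k) (N k : ℕ) : 0 ≤ truncSeq c N k := by
  unfold truncSeq
  split_ifs
  exacts [hc k, le_rfl]

lemma truncSeq_le (hc : ∀ k, 0 ≤ c k) (N k : ℕ) : truncSeq c N k ≤ c k := by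
  unfold truncSeq
  split_ifs
  exacts [le_rfl, hc k]

lemma truncSeq_of_lt {N k : ℕ} (h : k < N) : truncSeq c N k = c k := if_pos h

lemma summable_truncSeq (c : ℕ → ℝ) (N : ℕ) : Summable (truncSeq c N) :=
  summable_of_ne_finset_zero (s := Finset.range N) fun k hk =>
    if_neg (by simpa using hk)

lemma prod_one_add_mul_I_eq (c : ℕ → ℝ) (x : ℝ) (n : ℕ) :
    ∏ k ∈ Finset.range n, (1 + Complex.I * (c k * x : ℝ)) =
      ((cosSinPoly c n).1.eval (x ^ 2) : ℝ) +
        Complex.I * (x * (cosSinPoly c n).2.eval (x ^ 2) : ℝ) := by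
  induction n with
  | zero => simp [cosSinPoly]
  | succ n ih =>
    rw [Finset.prod_range_succ, ih, cosSinPoly]
    simp only [Polynomial.eval_sub, Polynomial.eval_add, Polynomial.eval_mul, Polynomial.eval_C,
      Polynomial.eval_X]
    push_cast
    linear_combination ((x : ℂ) ^ 2 * c n * ((cosSinPoly c n).2.eval (x ^ 2) : ℝ)) * Complex.I_sq

lemma exp_logMod_truncSeq (hc : ∀ k, 0 ≤ c k) (N : ℕ) (x : ℝ) :
    Complex.exp (logMod (truncSeq c N) x + phase (truncSeq c N) x * Complex.I) =
      ((cosSinPoly c N).1.eval (x ^ 2) : ℝ) +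
        Complex.I * (x * (cosSinPoly c N).2.eval (x ^ 2) : ℝ) := by
  rw [← prod_one_add_mul_I_eq]
  refine (hasProd_one_add_mul_I (truncSeq_nonneg hc N) (summable_truncSeq c N) x).unique ?_
  rw [Finset.prod_congr rfl fun k hk => by
    rw [← truncSeq_of_lt (c := c) (Finset.mem_range.1 hk)]]
  refine hasProd_prod_of_ne_finset_one fun k hk => ?_
  have : truncSeq c N k = 0 := if_neg (by simpa using hk)
  simp [this]

lemma exp_logMod_mul_cos_truncSeq (hc : ∀ k, 0 ≤ c k) (N : ℕ) (x : ℝ) :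
    Real.exp (logMod (truncSeq c N) x) * Real.cos (phase (truncSeq c N) x) =
      (cosSinPoly c N).1.eval (x ^ 2) := by
  have h := congrArg Complex.re (exp_logMod_truncSeq hc N x)
  rw [Complex.exp_re] at h
  simpa using h

lemma exp_logMod_mul_sin_truncSeq (hc : ∀ k, 0 ≤ c k) (N : ℕ) (x : ℝ) :
    Real.exp (logMod (truncSeq c N) x) * Real.sin (phase (truncSeq c N) x) =
      x * (cosSinPoly c N).2.eval (x ^ 2) := by
  have h := congrArg Complex.im (exp_logMod_truncSeq hc N x)
  rw [Complex.exp_im] at h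
  simpa using h

lemma natDegree_cosSinPoly_succ (c : ℕ → ℝ) {n d e f : ℕ} (h1 : (cosSinPoly c n).1.natDegree ≤ d)
    (h2 : (cosSinPoly c n).2.natDegree ≤ e) (hd : d ≤ f) (he : e + 1 ≤ f) :
    (cosSinPoly c (n + 1)).1.natDegree ≤ f ∧
      (cosSinPoly c (n + 1)).2.natDegree ≤ max e d := by
  constructor
  · refine (Polynomial.natDegree_sub_le _ _).trans (max_le (h1.trans hd) ?_)
    refine Polynomial.natDegree_mul_le.trans ?_
    have : (Polynomial.C (c n) * Polynomial.X).natDegree ≤ 1 :=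
      (Polynomial.natDegree_C_mul_le _ _).trans Polynomial.natDegree_X_le
    omega
  · refine (Polynomial.natDegree_add_le _ _).trans (max_le_max h2 ?_)
    exact (Polynomial.natDegree_C_mul_le _ _).trans h1

/-- The factor `X` enters only one of the two components, so two steps of the recursion raise the
degree bound by one. After an odd number of steps both bounds coincide. -/
lemma natDegree_cosSinPoly (c : ℕ → ℝ) (M : ℕ) :
    (cosSinPoly c (2 * M + 1)).1.natDegree ≤ M ∧ (cosSinPoly c (2 * M + 1)).2.natDegree ≤ M := by
  induction M with
  | zero => simp [cosSinPoly]
  | succ M ih =>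
    have h1 := natDegree_cosSinPoly_succ c ih.1 ih.2 (Nat.le_succ M) le_rfl
    rw [max_self] at h1
    have h2 := natDegree_cosSinPoly_succ c h1.1 h1.2 le_rfl le_rfl
    rw [max_eq_right (Nat.le_succ M)] at h2
    exact h2

/-- Euler's identity for the power sums weighted by the inverse derivative. -/
lemma sum_pow_div_eval_derivative {P : Polynomial ℝ} {M m : ℕ} (hP : P.natDegree ≤ M)
    {u : ℕ → ℝ} (hu : Set.InjOn u (Finset.range M)) (hroot : ∀ k < M, P.eval (u k) = 0)
    (hm : m + 1 < M) :
    ∑ k ∈ Finset.range M, u k ^ m / P.derivative.eval (u k) = 0 := by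
  set Q := Lagrange.nodal (Finset.range M) u with hQ
  have hQdeg : Q.natDegree = M := by rw [hQ, Lagrange.natDegree_nodal, Finset.card_range]
  have hQc : Q.coeff M = 1 := by
    have : Q.leadingCoeff = 1 := Lagrange.nodal_monic
    rwa [Polynomial.leadingCoeff, hQdeg] at this
  -- The difference has degree below `M` and vanishes at `M` distinct nodes. Should `P.coeff M` be
  -- 0, then `P = 0` and the identity below is trivial by division by zero.
  have hPQ : P = Polynomial.C (P.coeff M) * Q := by
    refine Polynomial.eq_of_degree_sub_lt_of_eval_index_eq (Finset.range M) hu ?_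
      fun k hk => ?_
    · rw [Finset.card_range, Polynomial.degree_lt_iff_coeff_zero]
      intro n hn
      rw [Polynomial.coeff_sub, Polynomial.coeff_C_mul]
      rcases hn.eq_or_lt with rfl | hn
      · rw [hQc, mul_one, sub_self]
      · rw [Polynomial.coeff_eq_zero_of_natDegree_lt (hP.trans_lt hn),
          Polynomial.coeff_eq_zero_of_natDegree_lt (hQdeg.trans_lt hn), mul_zero, sub_zero]
    · rw [hroot k (Finset.mem_range.1 hk), Polynomial.eval_mul, hQ,
        Lagrange.eval_nodal_at_node hk, mul_zero]
  have h1 : ∀ k ∈ Finset.range M, u k ^ m / P.derivative.eval (u k) =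
      (P.coeff M)⁻¹ * ((Polynomial.X ^ m : Polynomial ℝ).eval (u k) /
        ∏ j ∈ (Finset.range M).erase k, (u k - u j)) := fun k hk => by
    conv_lhs => rw [hPQ]
    rw [Polynomial.derivative_C_mul, Polynomial.eval_mul, Polynomial.eval_C, hQ,
      Lagrange.eval_nodal_derivative_eval_node_eq hk, Lagrange.eval_nodal, Polynomial.eval_pow,
      Polynomial.eval_X]
    ring
  -- By Lagrange interpolation the sum is the coefficient of `X ^ (M - 1)` in `X ^ m`, which is 0
  -- because `m < M - 1`.
  rw [Finset.sum_congr rfl h1, ← Finset.mul_sum, ← Lagrange.coeff_eq_sum hu,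
    Polynomial.coeff_X_pow, if_neg, mul_zero]
  · rw [Finset.card_range]
    omega
  · rw [Polynomial.degree_X_pow, Finset.card_range]
    exact_mod_cast (show m < M by omega)

lemma injOn_sq_of_phase_eq {c : ℕ → ℝ} {α : ℝ} {M : ℕ} {y : ℕ → ℝ}
    (hy : ∀ k < M, 0 < y k ∧ phase c (y k) = (k + α) * Real.pi) :
    Set.InjOn (fun k => y k ^ 2) (Finset.range M) := fun i hi j hj hij => by
  have hi' := hy i (by simpa using hi)
  have hj' := hy j (by simpa using hj)
  have h1 : y i = y j := (pow_left_inj₀ hi'.1.le hj'.1.le two_ne_zero).1 hij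
  have h2 := hi'.2.symm.trans ((congrArg (phase c) h1).trans hj'.2)
  have h3 := mul_right_cancel₀ Real.pi_ne_zero h2
  exact_mod_cast add_right_cancel h3

lemma sum_sin_truncSeq (hc : ∀ k, 0 ≤ c k) {M m : ℕ} (hm : m + 1 < M) {y : ℕ → ℝ}
    (hy : ∀ k < M, 0 < y k ∧ phase (truncSeq c (2 * M + 1)) (y k) = (k + 1) * Real.pi) :
    ∑ k ∈ Finset.range M,
      (-1) ^ (k + 1) * y k ^ (2 * (m + 1)) / zeroWeight (truncSeq c (2 * M + 1)) (y k) = 0 := by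
  set B := (cosSinPoly c (2 * M + 1)).2 with hB
  have hfun := exp_logMod_mul_sin_truncSeq hc (2 * M + 1)
  rw [← hB] at hfun
  have hroot : ∀ k < M, B.eval (y k ^ 2) = 0 := fun k hk => by
    have h := hfun (y k)
    rw [(hy k hk).2, sin_add_one_mul_pi, mul_zero] at h
    exact (mul_eq_zero.1 h.symm).resolve_left (hy k hk).1.ne'
  -- Differentiating `x B(x²)` at a root of `B(x²)` gives `2 x² B'(x²)`. The factor `x²` is why the
  -- power sums begin with exponent 2.
  have hder : ∀ k < M, (-1) ^ (k + 1) * zeroWeight (truncSeq c (2 * M + 1)) (y k) =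
      2 * y k ^ 2 * B.derivative.eval (y k ^ 2) := fun k hk => by
    have h1 := hasDerivAt_expMul_sin (truncSeq_nonneg hc (2 * M + 1))
      (summable_truncSeq c (2 * M + 1)) (x := y k) (by rw [(hy k hk).2, sin_add_one_mul_pi])
    rw [funext hfun] at h1
    have h2 := (hasDerivAt_id (y k)).mul
      ((B.hasDerivAt (y k ^ 2)).comp (y k) (hasDerivAt_pow 2 (y k)))
    have h3 := h1.unique h2
    rw [(hy k hk).2, cos_add_one_mul_pi] at h3
    simp only [Function.comp_apply, hroot k hk, id] at h3
    rw [zeroWeight, mul_comm, h3]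
    push_cast
    ring
  have h := sum_pow_div_eval_derivative (m := m) (natDegree_cosSinPoly c M).2
    (injOn_sq_of_phase_eq hy) hroot hm
  rw [← mul_zero (1 / 2 : ℝ), ← h, Finset.mul_sum]
  refine Finset.sum_congr rfl fun k hk => ?_
  have hk' := Finset.mem_range.1 hk
  have h1 : (-1 : ℝ) ^ (k + 1) * (-1) ^ (k + 1) = 1 := by
    rw [← mul_pow, neg_one_mul, neg_neg, one_pow]
  have h2 : (-1) ^ (k + 1) * y k ^ (2 * (m + 1)) / zeroWeight (truncSeq c (2 * M + 1)) (y k) =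
      y k ^ (2 * (m + 1)) / ((-1) ^ (k + 1) * zeroWeight (truncSeq c (2 * M + 1)) (y k)) := by
    rw [← mul_div_mul_left _ ((-1) ^ (k + 1) * _) (show (-1 : ℝ) ^ (k + 1) ≠ 0 by simp),
      ← mul_assoc ((-1 : ℝ) ^ (k + 1)) _ (zeroWeight _ _), h1, one_mul]
  rw [h2, hder k hk', ← hB]
  have hy0 := (hy k hk').1.ne'
  rw [show y k ^ (2 * (m + 1)) = y k ^ 2 * (y k ^ 2) ^ m by rw [mul_add_one, pow_add, pow_mul]; ring,
    mul_assoc 2, mul_left_comm, mul_div_mul_left _ _ (pow_ne_zero 2 hy0)]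
  ring

lemma sum_cos_truncSeq (hc : ∀ k, 0 ≤ c k) {M m : ℕ} (hm : m + 1 < M) {y : ℕ → ℝ}
    (hy : ∀ k < M, 0 < y k ∧ phase (truncSeq c (2 * M + 1)) (y k) = (k + 1 / 2) * Real.pi) :
    ∑ k ∈ Finset.range M,
      (-1) ^ (k + 1) * y k ^ (2 * m + 1) / zeroWeight (truncSeq c (2 * M + 1)) (y k) = 0 := by
  set A := (cosSinPoly c (2 * M + 1)).1 with hA
  have hfun := exp_logMod_mul_cos_truncSeq hc (2 * M + 1)
  rw [← hA] at hfun
  have hroot : ∀ k < M, A.eval (y k ^ 2) = 0 := fun k hk => by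
    rw [← hfun (y k), (hy k hk).2, cos_add_half_mul_pi, mul_zero]
  -- The derivative of `A(x²)` is `2 x A'(x²)`; the single factor `x` makes the exponents odd.
  have hder : ∀ k < M, (-1) ^ (k + 1) * zeroWeight (truncSeq c (2 * M + 1)) (y k) =
      2 * y k * A.derivative.eval (y k ^ 2) := fun k hk => by
    have h1 := hasDerivAt_expMul_cos (truncSeq_nonneg hc (2 * M + 1))
      (summable_truncSeq c (2 * M + 1)) (x := y k) (by rw [(hy k hk).2, cos_add_half_mul_pi])
    rw [funext hfun] at h1
    have h2 := (A.hasDerivAt (y k ^ 2)).comp (y k) (hasDerivAt_pow 2 (y k))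
    have h3 := h1.unique h2
    rw [(hy k hk).2, sin_add_half_mul_pi, ← zeroWeight] at h3
    rw [pow_succ]
    push_cast at h3
    linear_combination h3
  have h := sum_pow_div_eval_derivative (m := m) (natDegree_cosSinPoly c M).1
    (injOn_sq_of_phase_eq hy) hroot hm
  rw [← mul_zero (1 / 2 : ℝ), ← h, Finset.mul_sum]
  refine Finset.sum_congr rfl fun k hk => ?_
  have hk' := Finset.mem_range.1 hk
  have h1 : (-1 : ℝ) ^ (k + 1) * (-1) ^ (k + 1) = 1 := by
    rw [← mul_pow, neg_one_mul, neg_neg, one_pow]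
  have h2 : (-1) ^ (k + 1) * y k ^ (2 * m + 1) / zeroWeight (truncSeq c (2 * M + 1)) (y k) =
      y k ^ (2 * m + 1) / ((-1) ^ (k + 1) * zeroWeight (truncSeq c (2 * M + 1)) (y k)) := by
    rw [← mul_div_mul_left _ ((-1) ^ (k + 1) * _) (show (-1 : ℝ) ^ (k + 1) ≠ 0 by simp),
      ← mul_assoc ((-1 : ℝ) ^ (k + 1)) _ (zeroWeight _ _), h1, one_mul]
  rw [h2, hder k hk', ← hA]
  have hy0 := (hy k hk').1.ne'
  rw [show y k ^ (2 * m + 1) = y k * (y k ^ 2) ^ m by rw [pow_succ, pow_mul]; ring,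
    mul_assoc 2, mul_left_comm, mul_div_mul_left _ _ hy0]
  ring

/-! ### Removal of the truncation -/

lemma tendsto_tsum_truncSeq (hc : ∀ k, 0 ≤ c k) (hs : Summable c) {h : ℝ → ℝ → ℝ}
    (hcont : ∀ a, Continuous (h a)) (hb : ∀ a y, 0 ≤ a → |h a y| ≤ a * (1 + |y|))
    {N : ℕ → ℕ} (hN : Tendsto N atTop atTop) {y : ℕ → ℝ} {x : ℝ} (hy : Tendsto y atTop (𝓝 x)) :
    Tendsto (fun M => ∑' k, h (truncSeq c (N M) k) (y M)) atTop (𝓝 (∑' k, h (c k) x)) := by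
  -- Eventually `|y M| < |x| + 1`, and truncated weights never exceed the original ones.
  refine tendsto_tsum_of_dominated_convergence (hs.mul_right (1 + (|x| + 1))) (fun k => ?_) ?_
  · refine (((hcont (c k)).tendsto x).comp hy).congr' ?_
    filter_upwards [hN.eventually_gt_atTop k] with M hM
    rw [truncSeq_of_lt hM, Function.comp_apply]
  · filter_upwards [hy.abs.eventually (gt_mem_nhds (lt_add_one |x|))] with M hM k
    refine (hb _ _ (truncSeq_nonneg hc _ k)).trans ?_
    exact mul_le_mul (truncSeq_le hc _ k) (by linarith) (by positivity) (hc k)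

lemma tendsto_phase_truncSeq (hc : ∀ k, 0 ≤ c k) (hs : Summable c) {N : ℕ → ℕ}
    (hN : Tendsto N atTop atTop) (x : ℝ) :
    Tendsto (fun M => phase (truncSeq c (N M)) x) atTop (𝓝 (phase c x)) := by
  refine tendsto_tsum_truncSeq hc hs (h := fun a y => Real.arctan (a * y)) (fun a => ?_)
    (fun a y ha => ?_) hN tendsto_const_nhds
  · exact Real.continuous_arctan.comp (continuous_const_mul a)
  · refine (abs_arctan_le_abs _).trans ?_
    rw [abs_mul, abs_of_nonneg ha]
    nlinarith

lemma tendsto_zeroWeight_truncSeq (hc : ∀ k, 0 ≤ c k) (hs : Summable c) {N : ℕ → ℕ}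
    (hN : Tendsto N atTop atTop) {y : ℕ → ℝ} {x : ℝ} (hy : Tendsto y atTop (𝓝 x)) :
    Tendsto (fun M => zeroWeight (truncSeq c (N M)) (y M)) atTop (𝓝 (zeroWeight c x)) := by
  have h1 : ∀ a y : ℝ, 1 + (a * y) ^ 2 ≠ 0 := fun a y => by positivity
  refine Tendsto.mul ((Real.continuous_exp.tendsto _).comp ?_) ?_
  · refine tendsto_tsum_truncSeq hc hs (h := fun a y => Real.log (1 + (a * y) ^ 2) / 2)
      (fun a => ?_) (fun a y ha => ?_) hN hy
    · exact (Continuous.log (by fun_prop) (h1 a)).div_const 2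
    · rw [abs_of_nonneg (half_log_one_add_sq_nonneg _)]
      refine (half_log_one_add_sq_le _).trans ?_
      rw [abs_mul, abs_of_nonneg ha]
      nlinarith
  · refine tendsto_tsum_truncSeq hc hs (h := fun a y => a / (1 + (a * y) ^ 2))
      (fun a => ?_) (fun a y ha => ?_) hN hy
    · exact continuous_const.div (by fun_prop) (h1 a)
    · rw [abs_of_nonneg (div_nonneg ha (by positivity))]
      refine (div_le_self ha (by nlinarith [sq_nonneg (a * y)])).trans ?_
      nlinarith [mul_nonneg ha (abs_nonneg y)]

lemma phase_truncSeq_le (hc : ∀ k, 0 ≤ c k) (hs : Summable c) (N : ℕ) {x : ℝ} (hx : 0 ≤ x) :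
    phase (truncSeq c N) x ≤ phase c x :=
  (summable_phase (truncSeq_nonneg hc N) (summable_truncSeq c N) x).tsum_le_tsum
    (fun k => Real.arctan_strictMono.monotone
      (mul_le_mul_of_nonneg_right (truncSeq_le hc N k) hx)) (summable_phase hc hs x)

end

section

variable {q : ℝ}

/-- Truncation lowers the phase, so it moves every zero to the right. This gives half of the
convergence of the zeros and a majorant independent of the truncation. -/
lemma IsPhaseSeq.le_of_truncSeq (hq0 : 0 < q) (hq1 : q < 1) {α : ℝ} {x : ℕ → ℝ}
    (hx : IsPhaseSeq (qWeight q) α x) {N k : ℕ} {t : ℝ} (ht : 0 < t)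
    (h : phase (truncSeq (qWeight q) N) t = (k + α) * Real.pi) : x k ≤ t := by
  have hc := qWeight_nonneg hq0 hq1
  have hs := (hasSum_qWeight hq0 hq1).summable
  rw [← (strictMono_phase hc hs (qWeight_pos hq0 hq1 0)).le_iff_le, (hx k).2, ← h]
  exact phase_truncSeq_le hc hs N ht.le

lemma IsPhaseSeq.tendsto_of_truncSeq (hq0 : 0 < q) (hq1 : q < 1) {α : ℝ} {x : ℕ → ℝ}
    (hx : IsPhaseSeq (qWeight q) α x) {k : ℕ} {y : ℕ → ℝ}
    (hy : ∀ᶠ M in atTop, 0 < y M ∧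
      phase (truncSeq (qWeight q) (2 * M + 1)) (y M) = (k + α) * Real.pi) :
    Tendsto y atTop (𝓝 (x k)) := by
  have hc := qWeight_nonneg hq0 hq1
  have hs := (hasSum_qWeight hq0 hq1).summable
  have hN : Tendsto (fun M : ℕ => 2 * M + 1) atTop atTop :=
    tendsto_atTop_mono (fun M => by simp only [id]; omega) tendsto_id
  refine tendsto_order.2 ⟨fun a ha => ?_, fun b hb => ?_⟩
  · filter_upwards [hy] with M hM
    exact ha.trans_le (hx.le_of_truncSeq hq0 hq1 hM.1 hM.2)
  -- To the right of `x k` the full phase exceeds the level; hence so does the truncated one for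
  -- large `M`, and its zero lies to the left of `b`.
  · have h1 : (k + α) * Real.pi < phase (qWeight q) b := by
      rw [← (hx k).2]
      exact strictMono_phase hc hs (qWeight_pos hq0 hq1 0) hb
    filter_upwards [hy, (tendsto_phase_truncSeq hc hs hN b).eventually (lt_mem_nhds h1)]
      with M hM1 hM2
    rw [← hM1.2] at hM2
    refine (strictMono_phase (truncSeq_nonneg hc _) (summable_truncSeq _ _) ?_).lt_iff_lt.1 hM2
    rw [truncSeq_of_lt (by omega)]
    exact qWeight_pos hq0 hq1 0

/-- With `2 * M + 1` positive weights the phase approaches `(2M + 1) π / 2 > M π ≥ (k + α) π`, so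
the first `M` levels are attained. The implication under the quantifier allows a choice of `t` for
all `k`. -/
lemma exists_truncSeq_zeros (hq0 : 0 < q) (hq1 : q < 1) {α : ℝ} (hα0 : 0 < α) (hα1 : α ≤ 1)
    (M k : ℕ) : ∃ t, k < M → 0 < t ∧
      phase (truncSeq (qWeight q) (2 * M + 1)) t = (k + α) * Real.pi := by
  by_cases hk : k < M
  · obtain ⟨t, ht⟩ := exists_phase_eq (c := truncSeq (qWeight q) (2 * M + 1)) (N := 2 * M + 1)
      (y := (k + α) * Real.pi) (truncSeq_nonneg (qWeight_nonneg hq0 hq1) _)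
      (summable_truncSeq _ _) (fun k hk => by
        rw [truncSeq_of_lt hk]
        exact qWeight_pos hq0 hq1 k) (by positivity) (by
        have h1 : (k : ℝ) + 1 ≤ M := by exact_mod_cast hk
        push_cast
        nlinarith [Real.pi_pos])
    exact ⟨t, fun _ => ht⟩
  · exact ⟨0, fun h => absurd h hk⟩

lemma zeroWeight_truncSeq_pos (hq0 : 0 < q) (hq1 : q < 1) (M : ℕ) (x : ℝ) :
    0 < zeroWeight (truncSeq (qWeight q) (2 * M + 1)) x := by
  refine mul_pos (Real.exp_pos _) (phaseDeriv_pos (truncSeq_nonneg (qWeight_nonneg hq0 hq1) _)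
    (summable_truncSeq _ _) ?_ x)
  rw [truncSeq_of_lt (by omega)]
  exact qWeight_pos hq0 hq1 0

/-- The constant is free of `M` because the first `p + 3` weights survive the truncation. The 3
counts two powers lost in `zeroWeight_mul_sq_ge` and one kept as `t⁻¹`. -/
lemma pow_div_zeroWeight_truncSeq_le (hq0 : 0 < q) (hq1 : q < 1) {p M : ℕ} (hM : p + 3 ≤ 2 * M + 1)
    {t : ℝ} (ht : 1 ≤ t) :
    t ^ p / zeroWeight (truncSeq (qWeight q) (2 * M + 1)) t ≤
      ((∏ k ∈ Finset.range (p + 3), qWeight q k) * qWeight q 0 / 2)⁻¹ * t⁻¹ := by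
  have hc := qWeight_nonneg hq0 hq1
  have hz := zeroWeight_truncSeq_pos hq0 hq1 M t
  have h1 := zeroWeight_mul_sq_ge (truncSeq_nonneg hc (2 * M + 1)) (summable_truncSeq _ _)
    ((truncSeq_le hc _ 0).trans (qWeight_zero_le_one hq0)) (p + 3) ht
  rw [Finset.prod_congr rfl fun k hk => truncSeq_of_lt ((Finset.mem_range.1 hk).trans_le hM),
    truncSeq_of_lt (by omega)] at h1
  set D := (∏ k ∈ Finset.range (p + 3), qWeight q k) * qWeight q 0 / 2
  have hD : 0 < D := div_pos (mul_pos (Finset.prod_pos fun k _ => qWeight_pos hq0 hq1 k)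
    (qWeight_pos hq0 hq1 0)) two_pos
  have ht0 : 0 < t := by linarith
  rw [← mul_inv, ← one_div, div_le_div_iff₀ hz (by positivity), one_mul]
  refine le_of_mul_le_mul_right ?_ (pow_pos ht0 2)
  refine le_trans (le_of_eq ?_) h1
  ring

/-- The weighted power sums over the zeros vanish when they do so for the truncated products. -/
lemma IsPhaseSeq.tsum_eq_zero (hq0 : 0 < q) (hq1 : q < 1) {α : ℝ} (hα0 : 1 / 2 ≤ α) (hα1 : α ≤ 1)
    {x : ℕ → ℝ} (hx : IsPhaseSeq (qWeight q) α x) {p : ℕ}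
    (hfin : ∀ᶠ M in atTop, ∀ y : ℕ → ℝ, (∀ k < M, 0 < y k ∧
      phase (truncSeq (qWeight q) (2 * M + 1)) (y k) = (k + α) * Real.pi) →
      ∑ k ∈ Finset.range M,
        (-1) ^ (k + 1) * y k ^ p / zeroWeight (truncSeq (qWeight q) (2 * M + 1)) (y k) = 0) :
    ∑' k, (-1) ^ (k + 1) * x k ^ p / zeroWeight (qWeight q) (x k) = 0 := by
  have hc := qWeight_nonneg hq0 hq1
  have hs := (hasSum_qWeight hq0 hq1).summable
  have hN : Tendsto (fun M : ℕ => 2 * M + 1) atTop atTop :=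
    tendsto_atTop_mono (fun M => by simp only [id]; omega) tendsto_id
  choose y hy using exists_truncSeq_zeros hq0 hq1 (show 0 < α by linarith) hα1
  have hlim : ∀ k, Tendsto (fun M => y M k) atTop (𝓝 (x k)) := fun k =>
    hx.tendsto_of_truncSeq hq0 hq1 (by
      filter_upwards [eventually_gt_atTop k] with M hM
      exact hy M k hM)
  have hsum : Summable fun k => ((∏ k ∈ Finset.range (p + 3), qWeight q k) * qWeight q 0 / 2)⁻¹ *
      (x k)⁻¹ := by
    refine Summable.mul_left _ ((hx.summable_rpow hq0 hq1 hα0 (t := -1) (by norm_num)).congr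
      fun k => Real.rpow_neg_one _)
  have h1 := tendsto_tsum_of_dominated_convergence (𝓕 := atTop)
    (f := fun M k => if k < M then (-1) ^ (k + 1) * y M k ^ p /
      zeroWeight (truncSeq (qWeight q) (2 * M + 1)) (y M k) else 0)
    (g := fun k => (-1) ^ (k + 1) * x k ^ p / zeroWeight (qWeight q) (x k)) hsum
    (fun k => by
      have h2 := (((hlim k).pow p).const_mul ((-1) ^ (k + 1))).div
        (tendsto_zeroWeight_truncSeq hc hs hN (hlim k)) (zeroWeight_pos hq0 hq1 (x k)).ne'
      refine h2.congr' ?_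
      filter_upwards [eventually_gt_atTop k] with M hM
      rw [if_pos hM]
      rfl)
    (by
      filter_upwards [eventually_ge_atTop (p + 3)] with M hM k
      have hx0 := (hx k).1
      have hD : 0 ≤ (∏ k ∈ Finset.range (p + 3), qWeight q k) * qWeight q 0 / 2 :=
        div_nonneg (mul_nonneg (Finset.prod_nonneg fun k _ => hc k) (hc 0)) two_pos.le
      split_ifs with hk
      -- Since `x k ≤ y M k`, the bound in `(y M k)⁻¹` passes to the fixed summable majorant in `(x
      -- k)⁻¹`.
      · have hxy := hx.le_of_truncSeq hq0 hq1 (hy M k hk).1 (hy M k hk).2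
        have hy1 := (hx.one_le hq0 hq1 hα0 k).trans hxy
        rw [norm_div, norm_mul, norm_pow, norm_neg, norm_one, one_pow, one_mul,
          Real.norm_of_nonneg (pow_nonneg (hy M k hk).1.le p),
          Real.norm_of_nonneg (zeroWeight_truncSeq_pos hq0 hq1 M _).le]
        refine (pow_div_zeroWeight_truncSeq_le hq0 hq1 (by omega) hy1).trans ?_
        exact mul_le_mul_of_nonneg_left (inv_anti₀ hx0 hxy) (inv_nonneg.2 hD)
      · rw [norm_zero]
        exact mul_nonneg (inv_nonneg.2 hD) (inv_nonneg.2 hx0.le))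
  refine tendsto_nhds_unique h1 (tendsto_const_nhds.congr' ?_)
  filter_upwards [hfin] with M hM
  rw [tsum_eq_sum (s := Finset.range M) fun k hk => if_neg (by simpa using hk), ← hM (y M) (hy M)]
  exact (Finset.sum_congr rfl fun k hk => if_pos (Finset.mem_range.1 hk)).symm

lemma eta_term_eq_ofReal {x : ℝ} (p k : ℕ) (W : ℝ) :
    1 / (x : ℂ) ^ (-(p : ℂ)) * (1 / (((-1) ^ (k + 1) * W : ℝ) : ℂ)) =
      ((-1) ^ (k + 1) * x ^ p / W : ℝ) := by
  rw [Complex.cpow_neg, Complex.cpow_natCast]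
  push_cast
  rw [one_div, inv_inv, one_div, mul_inv, ← inv_pow, inv_neg_one]
  ring

lemma qEta_neg_even (hq0 : 0 < q) (hq1 : q < 1) (m : ℕ) :
    qEta q (-((2 * (m + 1) : ℕ) : ℂ)) = 0 := by
  have h := (isPhaseSeq_sinZero hq0 hq1).tsum_eq_zero hq0 hq1 (by norm_num) le_rfl
    (p := 2 * (m + 1)) (by
      filter_upwards [eventually_gt_atTop (m + 1)] with M hM y hy
      exact sum_sin_truncSeq (qWeight_nonneg hq0 hq1) hM hy)
  simp only [qEta, qEtaTerm, deriv_qSin_sinZero hq0 hq1, eta_term_eq_ofReal]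
  rw [← Complex.ofReal_tsum, h, Complex.ofReal_zero, neg_zero]

lemma qEtaStar_neg_odd (hq0 : 0 < q) (hq1 : q < 1) (m : ℕ) :
    qEtaStar q (-((2 * m + 1 : ℕ) : ℂ)) = 0 := by
  have h := (isPhaseSeq_cosZero hq0 hq1).tsum_eq_zero hq0 hq1 le_rfl (by norm_num)
    (p := 2 * m + 1) (by
      filter_upwards [eventually_gt_atTop (m + 1)] with M hM y hy
      exact sum_cos_truncSeq (qWeight_nonneg hq0 hq1) hM hy)
  simp only [qEtaStar, qEtaStarTerm, deriv_qCos_cosZero hq0 hq1, eta_term_eq_ofReal]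
  rw [← Complex.ofReal_tsum, h, Complex.ofReal_zero, neg_zero]

lemma one_lt_re_two_mul {n : ℕ} (hn : 1 ≤ n) : 1 < (2 * (n : ℂ)).re := by
  have : (1 : ℝ) ≤ n := by exact_mod_cast hn
  simp
  linarith

end

theorem mainTheorem10 (q : ℝ) (hq0 : 0 < q) (hq1 : q < 1) :
    -- the zeros and the series in the definitions are as they should be
    (ListsSimplePosZeros (qSin q) (sinZero q) ∧ ListsSimplePosZeros (qCos q) (cosZero q)) ∧
    (∀ s : ℂ, Summable (qEtaTerm q s) ∧ Summable (qEtaStarTerm q s)) ∧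
    (∀ s : ℂ, 1 < s.re → Summable (qZetaTerm q s) ∧ Summable (qZetaStarTerm q s)) ∧
    -- the two expansions
    (∀ s : ℂ, 1 < s.re →
      HasSum (fun j : ℕ =>
        (-1 : ℂ) ^ (j + 1) / (qFact q (2 * j) : ℂ) * (q : ℂ) ^ (j * (2 * j - 1)) *
          qEta q (s - 2 * (j : ℂ))) (qZeta q s)) ∧
    (∀ s : ℂ, 1 < s.re →
      HasSum (fun j : ℕ =>
        (-1 : ℂ) ^ j / (qFact q (2 * j + 1) : ℂ) * (q : ℂ) ^ (j * (2 * j + 1)) *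
          qEtaStar q (s - 2 * (j : ℂ) - 1)) (qZetaStar q s)) ∧
    -- the finite forms at the positive even integers
    (∀ n : ℕ, 1 ≤ n →
      qZeta q (2 * (n : ℂ)) = ∑ j ∈ Finset.range (n + 1),
        (-1 : ℂ) ^ (j + 1) / (qFact q (2 * j) : ℂ) * (q : ℂ) ^ (j * (2 * j - 1)) *
          qEta q (2 * (n : ℂ) - 2 * (j : ℂ))) ∧
    (∀ n : ℕ, 1 ≤ n →
      qZetaStar q (2 * (n : ℂ)) = ∑ j ∈ Finset.range n,
        (-1 : ℂ) ^ j / (qFact q (2 * j + 1) : ℂ) * (q : ℂ) ^ (j * (2 * j + 1)) *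
          qEtaStar q (2 * (n : ℂ) - 2 * (j : ℂ) - 1)) := by
  refine ⟨⟨listsSimplePosZeros_qSin hq0 hq1, listsSimplePosZeros_qCos hq0 hq1⟩,
    fun s => ⟨summable_qEtaTerm hq0 hq1 s, summable_qEtaStarTerm hq0 hq1 s⟩,
    fun s hs => ⟨summable_qZetaTerm hq0 hq1 hs, summable_qZetaStarTerm hq0 hq1 hs⟩,
    fun s hs => hasSum_qZeta hq0 hq1 hs, fun s hs => hasSum_qZetaStar hq0 hq1 hs,
    fun n hn => ?_, fun n hn => ?_⟩
  · refine (hasSum_qZeta hq0 hq1 (one_lt_re_two_mul hn)).unique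
      (hasSum_sum_of_ne_finset_zero fun j hj => ?_)
    -- Beyond `j = n` the argument of `qEta` is `-2(m + 1)`. At `j = n` it is 0, which the vanishing
    -- result does not cover, so that term stays.
    obtain ⟨m, rfl⟩ : ∃ m, j = n + (m + 1) :=
      ⟨j - n - 1, by rw [Finset.mem_range] at hj; omega⟩
    rw [show 2 * (n : ℂ) - 2 * ((n + (m + 1) : ℕ) : ℂ) = -((2 * (m + 1) : ℕ) : ℂ) by
      push_cast; ring, qEta_neg_even hq0 hq1, mul_zero]
  · refine (hasSum_qZetaStar hq0 hq1 (one_lt_re_two_mul hn)).unique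
      (hasSum_sum_of_ne_finset_zero fun j hj => ?_)
    -- Already from `j = n` on the argument is a negative odd integer, so this sum is one term
    -- shorter.
    obtain ⟨m, rfl⟩ := Nat.exists_eq_add_of_le (show n ≤ j by simpa using hj)
    rw [show 2 * (n : ℂ) - 2 * ((n + m : ℕ) : ℂ) - 1 = -((2 * m + 1 : ℕ) : ℂ) by
      push_cast; ring, qEtaStar_neg_odd hq0 hq1, mul_zero]
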